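/- Let $\lambda,\eta,m>0$, $\beta=\tfrac12\lambda^2\eta^2$ and $\mu=\min\{\lambda\eta,2m\}$. Consider the rescaled BPS system on $\mathbb R$ $$(m h',f',g')=-\bigl(\beta(f^2-1)+\beta g^2,\ m f h,\ m(h+1)g\bigr),\qquad (h,f,g)(-\infty)=(-1,0,1),\quad (h,f,g)(\infty)=(0,1,0).\tag{1}$$ (i) Problem (1) has a solution $(h,f,g)$, and it is unique up to translation: every solution has the form $x\mapsto(h,f,g)(x+x_0)$ for some $x_0\in\mathbb R$. The translate can be chosen such that $g(x)=f(x)e^{-mx}$ for all $x\in\mathbb R$. (ii) Let $(h,f,g)$ be the solution with this normalization. For every $\varepsilon>0$ there is a constant $C=C(\varepsilon)>0$ such that, for all $x$ sufficiently close to $-\infty$, $$-1<h(x)<-1+Ce^{\mu(1-\varepsilon)x},\quad e^{mx}>f(x)>e^{mx}\bigl(1-Ce^{\mu(1-\varepsilon)x}\bigr),\quad 1>g(x)>1-Ce^{\mu(1-\varepsilon)x},$$ and, for all sufficiently large $x$, $$0>h(x)>-Ce^{-\mu(1-\varepsilon)x},\quad 1>f(x)>1-Ce^{-\mu(1-\varepsilon)x},\quad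 e^{-mx}>g(x)>e^{-mx}\bigl(1-Ce^{-\mu(1-\varepsilon)x}\bigr).$$ (iii) Put $(Z,\Sigma,\Phi)=(\tfrac m\lambda h,\eta f,\eta g)$. Then $(Z,\Sigma,\Phi)$ is a BPS domain wall of the Burinskii–Morris model with superpotential $W=\frac\lambda2(\eta^2-\Sigma^2-\Phi^2)Z-\frac m2\Phi^2$: it solves $$(Z',\Sigma',\Phi')=(W_Z,W_\Sigma,W_\Phi),\qquad (Z,\Sigma,\Phi)(-\infty)=\bigl(-\tfrac m\lambda,0,\eta\bigr),\quad (Z,\Sigma,\Phi)(\infty)=(0,\eta,0),$$ and every solution of this problem is a translate of it. Moreover, for every $\varepsilon>0$, and also for $\varepsilon=0$ if $\lambda\eta\neq 2m$, $$Z+\tfrac m\lambda=O\bigl(e^{\mu(1-\varepsilon)x}\bigr),\quad \Sigma=O(e^{mx}),\quad \Phi-\eta=O\bigl(e^{\mu(1-\varepsilon)x}\bigr)\qquad(x\to-\infty),$$ $$Z=O\bigl(e^{-\mu(1-\varepsilon)x}\bigr),\quad \Sigma-\eta=O\bigl(e^{-\mu(1-\varepsilon)x}\bigr),\quad \Phi=O(e^{-mx})\qquad(x\to\infty).$$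 -/

import Mathlib

open Filter Topology Asymptotics

/-- `(h, f, g)` is a (differentiable) solution on the whole line of the rescaled BPS system
`(m h', f', g') = -(β (f² - 1) + β g², m f h, m (h + 1) g)` with the boundary condition
`(h, f, g)(-∞) = (-1, 0, 1)` and `(h, f, g)(∞) = (0, 1, 0)`. -/
structure IsRescaledWall (β m : ℝ) (h f g : ℝ → ℝ) : Prop where
  differentiable_h : Differentiable ℝ h
  differentiable_f : Differentiable ℝ f
  differentiable_g : Differentiable ℝ g
  eq_h : ∀ x, m * deriv h x = -(β * (f x ^ 2 - 1) + β * g x ^ 2)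
  eq_f : ∀ x, deriv f x = -(m * f x * h x)
  eq_g : ∀ x, deriv g x = -(m * (h x + 1) * g x)
  h_atBot : Tendsto h atBot (𝓝 (-1))
  f_atBot : Tendsto f atBot (𝓝 0)
  g_atBot : Tendsto g atBot (𝓝 1)
  h_atTop : Tendsto h atTop (𝓝 0)
  f_atTop : Tendsto f atTop (𝓝 1)
  g_atTop : Tendsto g atTop (𝓝 0)

/-- The superpotential `W = (λ/2)(η² - Σ² - Φ²) Z - (m/2) Φ²` of the Burinskii–Morris model, as a
function of `(Z, Σ, Φ) = (z, s, p)`. -/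
noncomputable def superpotential (lam η m z s p : ℝ) : ℝ :=
  lam / 2 * (η ^ 2 - s ^ 2 - p ^ 2) * z - m / 2 * p ^ 2

theorem deriv_superpotential_fst (lam η m z s p : ℝ) :
    deriv (fun t => superpotential lam η m t s p) z = -(lam / 2 * (s ^ 2 + p ^ 2 - η ^ 2)) := by
  have h : HasDerivAt (fun t => superpotential lam η m t s p)
      (lam / 2 * (η ^ 2 - s ^ 2 - p ^ 2) * 1) z :=
    ((hasDerivAt_id z).const_mul (lam / 2 * (η ^ 2 - s ^ 2 - p ^ 2))).sub_const _
  rw [h.deriv]; ring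

theorem deriv_superpotential_snd (lam η m z s p : ℝ) :
    deriv (fun t => superpotential lam η m z t p) s = -(lam * z * s) := by
  have h : HasDerivAt (fun t => superpotential lam η m z t p) _ s :=
    (((((hasDerivAt_id s).pow 2).const_sub (η ^ 2)).sub_const (p ^ 2)).const_mul
      (lam / 2)).mul_const z |>.sub_const (m / 2 * p ^ 2)
  rw [h.deriv]; simp; ring

theorem deriv_superpotential_trd (lam η m z s p : ℝ) :
    deriv (fun t => superpotential lam η m z s t) p = -((lam * z + m) * p) := by
  have h : HasDerivAt (fun t => superpotential lam η m z s t) _ p :=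
    ((((hasDerivAt_id p).pow 2).const_sub (η ^ 2 - s ^ 2)).const_mul
      (lam / 2)).mul_const z |>.sub (((hasDerivAt_id p).pow 2).const_mul (m / 2))
  rw [h.deriv]; simp; ring

/-- `(Z, S, P) = (Z, Σ, Φ)` is a BPS domain wall of the Burinskii–Morris model: a (differentiable)
solution on the whole line of the BPS system `(Z', Σ', Φ') = (W_Z, W_Σ, W_Φ)` (upper sign) that
connects the ground state `(-m/λ, 0, η)` at `-∞` to the ground state `(0, η, 0)` at `∞`. -/
structure IsBPSWall (lam η m : ℝ) (Z S P : ℝ → ℝ) : Prop where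
  differentiable_Z : Differentiable ℝ Z
  differentiable_S : Differentiable ℝ S
  differentiable_P : Differentiable ℝ P
  eq_Z : ∀ x, deriv Z x = deriv (fun t => superpotential lam η m t (S x) (P x)) (Z x)
  eq_S : ∀ x, deriv S x = deriv (fun t => superpotential lam η m (Z x) t (P x)) (S x)
  eq_P : ∀ x, deriv P x = deriv (fun t => superpotential lam η m (Z x) (S x) t) (P x)
  Z_atBot : Tendsto Z atBot (𝓝 (-(m / lam)))
  S_atBot : Tendsto S atBot (𝓝 0)
  P_atBot : Tendsto P atBot (𝓝 η)
  Z_atTop : Tendsto Z atTop (𝓝 0)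
  S_atTop : Tendsto S atTop (𝓝 η)
  P_atTop : Tendsto P atTop (𝓝 0)

/-- The exponential estimates at `-∞` with rate `r`, constant `C` and `ε`-loss. -/
def EstimatesAtBot (m r ε C : ℝ) (h f g : ℝ → ℝ) : Prop :=
  ∀ᶠ x in atBot,
    (-1 < h x ∧ h x < -1 + C * Real.exp (r * (1 - ε) * x)) ∧
    (f x < Real.exp (m * x) ∧
      Real.exp (m * x) * (1 - C * Real.exp (r * (1 - ε) * x)) < f x) ∧
    (g x < 1 ∧ 1 - C * Real.exp (r * (1 - ε) * x) < g x)

/-- The exponential estimates at `∞` with rate `r`, constant `C` and `ε`-loss. -/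
def EstimatesAtTop (m r ε C : ℝ) (h f g : ℝ → ℝ) : Prop :=
  ∀ᶠ x in atTop,
    (h x < 0 ∧ -(C * Real.exp (-(r * (1 - ε) * x))) < h x) ∧
    (f x < 1 ∧ 1 - C * Real.exp (-(r * (1 - ε) * x)) < f x) ∧
    (g x < Real.exp (-(m * x)) ∧
      Real.exp (-(m * x)) * (1 - C * Real.exp (-(r * (1 - ε) * x))) < g x)

/-- The orders of convergence at `±∞` of the fields `(Z, S, P) = (Z, Σ, Φ)` to the two ground
states: rate `m` for `Σ` at `-∞` and for `Φ` at `∞`, and rate `r` for all others. -/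
def WallDecay (lam η m r : ℝ) (Z S P : ℝ → ℝ) : Prop :=
  ((fun x => Z x + m / lam) =O[atBot] fun x => Real.exp (r * x)) ∧
  (S =O[atBot] fun x => Real.exp (m * x)) ∧
  ((fun x => P x - η) =O[atBot] fun x => Real.exp (r * x)) ∧
  (Z =O[atTop] fun x => Real.exp (-(r * x))) ∧
  ((fun x => S x - η) =O[atTop] fun x => Real.exp (-(r * x))) ∧
  (P =O[atTop] fun x => Real.exp (-(m * x)))

/-!
The equations for `f` and `g` are linear, so `f > 0` and `g = c f exp (-m x)` with a constant
`c > 0` that a translation normalizes to `1`. Then `u = log f` satisfies the scalar equation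
`u'' = β ((1 + exp (-2 m x)) exp (2 u) - 1)`, whose right-hand side increases with `u`. This gives
uniqueness: the difference of two solutions tends to `0` at `±∞` and has no negative minimum
(`IsRescaledWall.f_le_f`). Uniqueness makes the wall invariant under the reflection
`(h, f, g)(x) ↦ (-1 - h, g, f)(-x)`, so all estimates at `-∞` follow from those at `∞`.

For existence put `v = log (f² + g²) / 2`, which turns the problem into
`v'' = β (exp (2 v) - 1) + m² / (2 cosh² (m x))`, `v (±∞) = 0` (`IsProfile`). Here `0` is a
supersolution, and `(L (m x) - p L (m x / p)) / 2` with `L = log (2 cosh)` is a subsolution for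
integers `p ≥ max 2 (m² / β)`. Inverting `w ↦ w'' - 2 β w` on bounded functions gives a fixed point
problem that is a contraction between the two (`exists_profile`).

For the decay, `y = -v ≥ 0` satisfies `y'' ≥ k² y - O(y²) - O(exp (-2 m x))` with
`k² = 2 β = (λ η)²`. Comparison with `A exp (-κ x) + D exp (-ρ x)`
(`exp_decay_of_second_deriv_ge`) yields every rate below `min k (2 m)`, and off the resonance
`k = 2 m` also that rate itself (`IsProfile.decay`). Integrating `h' = β (1 - exp (2 v)) / m` and
`f' = -m f h` from `∞` carries the rate over to `h` and `f` (`IsRescaledWall.decay_atTop`).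
-/

/-! ### Maximum principles -/

theorem IsLocalMin.second_deriv_nonneg {w w' : ℝ → ℝ} {a c : ℝ}
    (hw : ∀ x, HasDerivAt w (w' x) x) (hw' : HasDerivAt w' c a) (hmin : IsLocalMin w a) :
    0 ≤ c := by
  by_contra! hc
  have hd : deriv (fun x => -w x) = fun x => -w' x := funext fun x => (hw x).neg.deriv
  have hwa : w' a = 0 := hmin.hasDerivAt_eq_zero (hw a)
  have hmax : IsLocalMin (fun x => -w x) a := by
    apply isLocalMin_of_deriv_deriv_pos
    · rw [hd, show deriv (fun x => -w' x) a = -c from hw'.neg.deriv]; linarith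
    · rw [hd]; simp [hwa]
    · exact (hw a).neg.continuousAt
  -- `a` is both a local minimum and a local maximum, so `w` is constant near `a`
  have hconst : w =ᶠ[𝓝 a] fun _ => w a := by
    filter_upwards [hmin, hmax] with x h1 h2
    linarith
  have hderiv : w' =ᶠ[𝓝 a] fun _ => 0 := by
    filter_upwards [hconst.eventuallyEq_nhds] with x hx
    have := hx.deriv_eq
    rwa [(hw x).deriv, deriv_const] at this
  have := hderiv.deriv_eq
  rw [hw'.deriv, deriv_const] at this
  exact hc.ne this

theorem le_on_Icc_of_second_deriv_neg {w w' w'' : ℝ → ℝ} (hw : ∀ x, HasDerivAt w (w' x) x)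
    (hw' : ∀ x, HasDerivAt w' (w'' x) x) {a b c : ℝ} (hc : c ≤ 0)
    (hneg : ∀ x ∈ Set.Ioo a b, w x < 0 → w'' x < 0) (ha : c ≤ w a) (hb : c ≤ w b)
    {x : ℝ} (hx : x ∈ Set.Icc a b) : c ≤ w x := by
  have hcont : Continuous w := continuous_iff_continuousAt.2 fun x => (hw x).continuousAt
  obtain ⟨z, hz, hzmin⟩ := isCompact_Icc.exists_isMinOn ⟨x, hx⟩ hcont.continuousOn
  refine le_trans ?_ (hzmin hx)
  by_contra! hlt
  have hza : z ≠ a := by rintro rfl; linarith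
  have hzb : z ≠ b := by rintro rfl; linarith
  have hz' : z ∈ Set.Ioo a b := ⟨lt_of_le_of_ne hz.1 hza.symm, lt_of_le_of_ne hz.2 hzb⟩
  have := (hzmin.isLocalMin (Icc_mem_nhds hz'.1 hz'.2)).second_deriv_nonneg hw (hw' z)
  linarith [hneg z hz' (by linarith)]

/-- Maximum principle on the line: a function that is concave wherever it is negative and whose
lower limits at `±∞` are nonnegative is nonnegative. -/
theorem nonneg_of_second_deriv_neg {w w' w'' : ℝ → ℝ} (hw : ∀ x, HasDerivAt w (w' x) x)
    (hw' : ∀ x, HasDerivAt w' (w'' x) x) (hneg : ∀ x, w x < 0 → w'' x < 0)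
    (hbot : ∀ ε > 0, ∀ᶠ x in atBot, -ε ≤ w x) (htop : ∀ ε > 0, ∀ᶠ x in atTop, -ε ≤ w x)
    (x : ℝ) : 0 ≤ w x := by
  refine le_of_forall_pos_le_add fun ε hε => ?_
  obtain ⟨a, ha, hax⟩ := ((hbot ε hε).and (eventually_le_atBot x)).exists
  obtain ⟨b, hb, hbx⟩ := ((htop ε hε).and (eventually_ge_atTop x)).exists
  have := le_on_Icc_of_second_deriv_neg hw hw' (c := -ε) (by linarith)
    (fun y _ => hneg y) ha hb ⟨hax, hbx⟩
  linarith

/-- Maximum principle on a half-line. -/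
theorem nonneg_on_Ici_of_second_deriv_neg {w w' w'' : ℝ → ℝ}
    (hw : ∀ x, HasDerivAt w (w' x) x) (hw' : ∀ x, HasDerivAt w' (w'' x) x) {a : ℝ}
    (hneg : ∀ x, a < x → w x < 0 → w'' x < 0) (ha : 0 ≤ w a) (htop : Tendsto w atTop (𝓝 0))
    {x : ℝ} (hx : a ≤ x) : 0 ≤ w x := by
  refine le_of_forall_pos_le_add fun ε hε => ?_
  obtain ⟨b, hb, hbx⟩ := ((htop.eventually (lt_mem_nhds (neg_lt_zero.2 hε))).and
    (eventually_ge_atTop x)).exists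
  have := le_on_Icc_of_second_deriv_neg hw hw' (c := -ε) (by linarith)
    (fun y hy => hneg y hy.1) (by linarith) hb.le ⟨hx, hbx⟩
  linarith

/-- Maximum principle for bounded supersolutions of `w'' = k² w`. -/
theorem nonneg_of_second_deriv_le {w w' w'' : ℝ → ℝ} {k B : ℝ} (hk : 0 < k)
    (hw : ∀ x, HasDerivAt w (w' x) x) (hw' : ∀ x, HasDerivAt w' (w'' x) x)
    (hB : ∀ x, -B ≤ w x) (hle : ∀ x, w'' x ≤ k ^ 2 * w x) (x : ℝ) : 0 ≤ w x := by
  -- `w + ε (x² + 2 / k²)` is a supersolution as well, and it is positive near `±∞`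
  have key : ∀ ε > 0, 0 ≤ w x + ε * (x ^ 2 + 2 / k ^ 2) := by
    intro ε hε
    have hev : ∀ l : Filter ℝ, Tendsto (fun x : ℝ => x ^ 2) l atTop →
        ∀ δ > 0, ∀ᶠ x in l, -δ ≤ w x + ε * (x ^ 2 + 2 / k ^ 2) := by
      intro l hl δ hδ
      filter_upwards [hl.eventually_ge_atTop (B / ε)] with y hy
      have h1 : B ≤ ε * y ^ 2 := by rwa [div_le_iff₀' hε] at hy
      have h2 : 0 ≤ ε * (2 / k ^ 2) := by positivity
      linarith [hB y]
    refine nonneg_of_second_deriv_neg (w := fun x => w x + ε * (x ^ 2 + 2 / k ^ 2))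
      (w' := fun x => w' x + ε * (2 * x)) (w'' := fun x => w'' x + ε * 2) ?_ ?_ ?_
      (hev _ ?_) (hev _ (tendsto_pow_atTop two_ne_zero)) x
    · intro y
      exact ((hw y).add ((((hasDerivAt_id y).pow 2).add_const (2 / k ^ 2)).const_mul ε)).congr_deriv
        (by simp)
    · intro y
      exact ((hw' y).add (((hasDerivAt_id y).const_mul 2).const_mul ε)).congr_deriv (by simp)
    · intro y hy
      have h1 : k ^ 2 * (2 / k ^ 2) = 2 := by field_simp
      have h2 : 0 ≤ k ^ 2 * (ε * y ^ 2) := by positivity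
      have h3 : k ^ 2 * (w y + ε * (y ^ 2 + 2 / k ^ 2)) < 0 :=
        mul_neg_of_pos_of_neg (by positivity) hy
      have h4 := hle y
      have h5 : k ^ 2 * (w y + ε * (y ^ 2 + 2 / k ^ 2))
        = k ^ 2 * w y + k ^ 2 * (ε * y ^ 2) + ε * (k ^ 2 * (2 / k ^ 2)) := by ring
      rw [h1] at h5
      linarith
    · simpa [Function.comp_def] using
        (tendsto_pow_atTop (α := ℝ) two_ne_zero).comp tendsto_abs_atBot_atTop

  have hlim : Tendsto (fun ε : ℝ => w x + ε * (x ^ 2 + 2 / k ^ 2)) (𝓝[>] 0) (𝓝 (w x)) := by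
    have : Continuous fun ε : ℝ => w x + ε * (x ^ 2 + 2 / k ^ 2) := by fun_prop
    simpa using (this.tendsto 0).mono_left nhdsWithin_le_nhds
  exact ge_of_tendsto hlim (by filter_upwards [self_mem_nhdsWithin] with ε hε using key ε hε)

/-! ### Bounded solutions of linear equations -/

open MeasureTheory in
theorem exists_bounded_solution_first_order {k B : ℝ} (hk : 0 < k) {φ : ℝ → ℝ}
    (hφ : Continuous φ) (hB : ∀ x, |φ x| ≤ B) :
    ∃ p : ℝ → ℝ, (∀ x, HasDerivAt p (-(k * p x) + φ x) x) ∧ ∀ x, |p x| ≤ B / k := by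
  set e : ℝ → ℝ := fun y => Real.exp (k * y) * φ y with he
  have hec : Continuous e := by fun_prop
  have hbd : ∀ y, ‖e y‖ ≤ B * Real.exp (k * y) := by
    intro y
    rw [he, norm_mul, Real.norm_eq_abs, Real.norm_eq_abs, Real.abs_exp, mul_comm]
    exact mul_le_mul_of_nonneg_right (hB y) (Real.exp_pos _).le
  have hint : ∀ x, IntegrableOn e (Set.Iic x) := fun x =>
    Integrable.mono' ((integrableOn_exp_mul_Iic hk x).const_mul B)
      hec.aestronglyMeasurable (Eventually.of_forall hbd)
  have hF : ∀ x, HasDerivAt (fun x => ∫ y in Set.Iic x, e y) (e x) x := by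
    intro x
    have h1 : (fun x => ∫ y in Set.Iic x, e y) =
        fun x => (∫ y in (0 : ℝ)..x, e y) + ∫ y in Set.Iic 0, e y := by
      funext z
      rw [← intervalIntegral.integral_Iic_sub_Iic (hint 0) (hint z)]; ring
    rw [h1]
    exact (hec.integral_hasStrictDerivAt 0 x).hasDerivAt.add_const _
  refine ⟨fun x => Real.exp (-(k * x)) * ∫ y in Set.Iic x, e y, fun x => ?_, fun x => ?_⟩
  · have h1 : HasDerivAt (fun x => Real.exp (-(k * x))) (Real.exp (-(k * x)) * -(k * 1)) x :=
      (((hasDerivAt_id x).const_mul k).neg).exp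
    refine (h1.mul (hF x)).congr_deriv ?_
    have h2 : Real.exp (-(k * x)) * Real.exp (k * x) = 1 := by rw [← Real.exp_add]; simp
    rw [show e x = Real.exp (k * x) * φ x from rfl]
    linear_combination φ x * h2
  · have h1 : ‖∫ y in Set.Iic x, e y‖ ≤ B * (Real.exp (k * x) / k) := by
      rw [← integral_exp_mul_Iic hk x, ← integral_const_mul]
      exact norm_integral_le_of_norm_le ((integrableOn_exp_mul_Iic hk x).const_mul B)
        (Eventually.of_forall hbd)
    rw [abs_mul, Real.abs_exp]
    calc Real.exp (-(k * x)) * |∫ y in Set.Iic x, e y|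
        ≤ Real.exp (-(k * x)) * (B * (Real.exp (k * x) / k)) :=
          mul_le_mul_of_nonneg_left h1 (Real.exp_pos _).le
      _ = (Real.exp (-(k * x)) * Real.exp (k * x)) * (B / k) := by ring
      _ = B / k := by rw [← Real.exp_add]; simp

/-- The equation factors as `(D - k) (D + k) w = φ`; the backward factor is solved by reflecting
the forward one. -/
theorem exists_bounded_solution_second_order {k B : ℝ} (hk : 0 < k) {φ : ℝ → ℝ}
    (hφ : Continuous φ) (hB : ∀ x, |φ x| ≤ B) :
    ∃ w w' : ℝ → ℝ, (∀ x, HasDerivAt w (w' x) x) ∧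
      (∀ x, HasDerivAt w' (k ^ 2 * w x + φ x) x) ∧ ∃ D, ∀ x, |w x| ≤ D := by
  obtain ⟨p, hp, hpB⟩ := exists_bounded_solution_first_order hk hφ hB
  obtain ⟨r, hr, hrB⟩ := exists_bounded_solution_first_order hk (φ := fun x => φ (-x))
    (by fun_prop) (fun x => hB (-x))
  have hr' : ∀ x, HasDerivAt (fun x => r (-x)) (-(-(k * r (-x)) + φ x)) x := by
    intro x
    have h := (hr (-x)).scomp x (hasDerivAt_neg x)
    simp only [neg_neg] at h
    simpa [Function.comp_def] using h
  refine ⟨fun x => (-r (-x) - p x) / (2 * k), fun x => (p x - r (-x)) / 2, fun x => ?_,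
    fun x => ?_, (B / k + B / k) / (2 * k), fun x => ?_⟩
  · refine (((hr' x).neg.sub (hp x)).div_const (2 * k)).congr_deriv ?_
    field_simp; ring
  · refine (((hp x).sub (hr' x)).div_const 2).congr_deriv ?_
    field_simp; ring
  · rw [abs_div, abs_of_pos (by positivity : 0 < 2 * k)]
    gcongr
    refine (abs_sub _ _).trans ?_
    rw [abs_neg]
    exact add_le_add (hrB _) (hpB _)

/-! ### The function `log (2 cosh x)` -/

/-- A smooth even regularization of `|x|`, exact up to exponentially small errors. -/
noncomputable def logTwoCosh (x : ℝ) : ℝ := Real.log (2 * Real.cosh x)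

theorem logTwoCosh_neg (x : ℝ) : logTwoCosh (-x) = logTwoCosh x := by simp [logTwoCosh]

theorem two_mul_cosh (x : ℝ) : 2 * Real.cosh x = Real.exp x + Real.exp (-x) := by
  rw [Real.cosh_eq]; ring

theorem exp_logTwoCosh (x : ℝ) : Real.exp (logTwoCosh x) = Real.exp x + Real.exp (-x) := by
  have := Real.cosh_pos x
  rw [logTwoCosh, Real.exp_log (by positivity), two_mul_cosh]

theorem hasDerivAt_logTwoCosh (c x : ℝ) :
    HasDerivAt (fun x => logTwoCosh (c * x)) (c * Real.tanh (c * x)) x := by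
  have hpos := Real.cosh_pos (c * x)
  have h := ((((hasDerivAt_id x).const_mul c).cosh).const_mul 2).log
    (by simp only [id]; positivity)
  refine h.congr_deriv ?_
  rw [Real.tanh_eq_sinh_div_cosh]
  simp only [id]
  field_simp

theorem hasDerivAt_mul_tanh (c x : ℝ) :
    HasDerivAt (fun x => c * Real.tanh (c * x)) (c ^ 2 / Real.cosh (c * x) ^ 2) x := by
  have hpos := Real.cosh_pos (c * x)
  have hlin := (hasDerivAt_id x).const_mul c
  have h := ((hlin.sinh).div hlin.cosh (by simp only [id]; positivity)).const_mul c
  have heq : (fun x => c * Real.tanh (c * x)) = fun x =>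
      c * (Real.sinh (c * x) / Real.cosh (c * x)) := by
    funext y; rw [Real.tanh_eq_sinh_div_cosh]
  rw [heq]
  refine h.congr_deriv ?_
  simp only [id]
  have := Real.cosh_sq (c * x)
  field_simp
  linear_combination c ^ 2 * this

theorem logTwoCosh_sub_self (x : ℝ) :
    logTwoCosh x - x = Real.log (1 + Real.exp (-(2 * x))) := by
  rw [logTwoCosh, two_mul_cosh, show Real.exp x + Real.exp (-x)
    = Real.exp x * (1 + Real.exp (-(2 * x))) by
      rw [mul_add, ← Real.exp_add]; ring_nf,
    Real.log_mul (Real.exp_pos _).ne' (by positivity), Real.log_exp]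
  ring

theorem le_logTwoCosh (x : ℝ) : x ≤ logTwoCosh x := by
  have h := logTwoCosh_sub_self x
  have : 0 ≤ Real.log (1 + Real.exp (-(2 * x))) :=
    Real.log_nonneg (by linarith [Real.exp_pos (-(2 * x))])
  linarith

theorem abs_le_logTwoCosh (x : ℝ) : |x| ≤ logTwoCosh x :=
  abs_le'.2 ⟨le_logTwoCosh x, by simpa [logTwoCosh_neg] using le_logTwoCosh (-x)⟩

theorem logTwoCosh_le (x : ℝ) : logTwoCosh x ≤ |x| + Real.log 2 := by
  have h := Real.cosh_pos x
  rw [← Real.log_exp |x|, ← Real.log_mul (Real.exp_pos _).ne' two_ne_zero]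
  refine Real.log_le_log (by positivity) ?_
  rw [two_mul_cosh]
  have h1 := Real.exp_le_exp.2 (le_abs_self x)
  have h2 := Real.exp_le_exp.2 (neg_le_abs x)
  linarith

theorem tendsto_logTwoCosh_sub_atTop {c : ℝ} (hc : 0 < c) :
    Tendsto (fun x => logTwoCosh (c * x) - c * x) atTop (𝓝 0) := by
  have h1 : Tendsto (fun x : ℝ => -(2 * (c * x))) atTop atBot :=
    tendsto_neg_atTop_atBot.comp ((tendsto_id.const_mul_atTop hc).const_mul_atTop two_pos)
  have h2 := (Real.tendsto_exp_atBot.comp h1).const_add 1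
  have h3 := ((Real.continuousAt_log (by norm_num : (1 : ℝ) + 0 ≠ 0)).tendsto.comp h2)
  simp only [add_zero, Real.log_one] at h3
  exact h3.congr fun x => (logTwoCosh_sub_self (c * x)).symm

theorem tendsto_logTwoCosh_add_atBot {c : ℝ} (hc : 0 < c) :
    Tendsto (fun x => logTwoCosh (c * x) + c * x) atBot (𝓝 0) := by
  refine ((tendsto_logTwoCosh_sub_atTop hc).comp tendsto_neg_atBot_atTop).congr fun x => ?_
  simp only [Function.comp, mul_neg, logTwoCosh_neg]
  ring

/-! ### The subsolution -/

/-- The function `v` with `exp (2 v) = (aᵖ + bᵖ) / (a + b)ᵖ`, where `p = n + 2`, `a = exp (c x)` and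
`b = 1 / a`. With `p c = m` the first logarithm produces the inhomogeneity of the profile equation,
and the second one contributes only `O(1 / p)` to `v''`. -/
noncomputable def subsolution (n : ℕ) (c x : ℝ) : ℝ :=
  1 / 2 * (logTwoCosh ((n + 2) * c * x) - (n + 2) * logTwoCosh (c * x))

theorem hasDerivAt_subsolution (n : ℕ) (c x : ℝ) :
    HasDerivAt (subsolution n c) (1 / 2 * ((n + 2) * c * Real.tanh ((n + 2) * c * x) -
      (n + 2) * (c * Real.tanh (c * x)))) x :=
  ((hasDerivAt_logTwoCosh _ x).sub ((hasDerivAt_logTwoCosh c x).const_mul _)).const_mul _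

theorem hasDerivAt_deriv_subsolution (n : ℕ) (c x : ℝ) :
    HasDerivAt (fun x => 1 / 2 * ((n + 2) * c * Real.tanh ((n + 2) * c * x) -
      (n + 2) * (c * Real.tanh (c * x)))) (1 / 2 * (((n + 2) * c) ^ 2 /
        Real.cosh ((n + 2) * c * x) ^ 2 - (n + 2) * (c ^ 2 / Real.cosh (c * x) ^ 2))) x :=
  ((hasDerivAt_mul_tanh _ x).sub ((hasDerivAt_mul_tanh c x).const_mul _)).const_mul _

theorem exp_two_mul_subsolution_le (n : ℕ) (c x : ℝ) :
    Real.exp (2 * subsolution n c x) ≤ 1 - 1 / (2 * Real.cosh (c * x) ^ 2) := by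
  set a := Real.exp (c * x) with ha
  set b := Real.exp (-(c * x)) with hb
  have ha0 : 0 < a := Real.exp_pos _
  have hb0 : 0 < b := Real.exp_pos _
  have hab : a * b = 1 := by rw [ha, hb, ← Real.exp_add]; simp
  have hL : Real.exp (logTwoCosh (c * x)) = a + b := exp_logTwoCosh _
  have hLp : Real.exp (logTwoCosh ((n + 2) * c * x)) = a ^ (n + 2) + b ^ (n + 2) := by
    rw [exp_logTwoCosh, ha, hb, ← Real.exp_nat_mul, ← Real.exp_nat_mul]
    push_cast; ring_nf
  have h1 : Real.exp (2 * subsolution n c x) = (a ^ (n + 2) + b ^ (n + 2)) / (a + b) ^ (n + 2) := by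
    rw [subsolution, show 2 * (1 / 2 * (logTwoCosh ((n + 2) * c * x) -
      (n + 2) * logTwoCosh (c * x))) = logTwoCosh ((n + 2) * c * x) -
      ((n + 2 : ℕ) : ℝ) * logTwoCosh (c * x) by push_cast; ring, Real.exp_sub,
      Real.exp_nat_mul, hL, hLp]
  have h2 : Real.cosh (c * x) = (a + b) / 2 := Real.cosh_eq _
  have hpow : a ^ (n + 2) + b ^ (n + 2) ≤ (a ^ 2 + b ^ 2) * (a + b) ^ n := by
    have h3 : a ^ n ≤ (a + b) ^ n := by gcongr; linarith
    have h4 : b ^ n ≤ (a + b) ^ n := by gcongr; linarith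
    have h5 := mul_le_mul_of_nonneg_left h3 (sq_nonneg a)
    have h6 := mul_le_mul_of_nonneg_left h4 (sq_nonneg b)
    rw [pow_add, pow_add]
    linarith
  rw [h1, h2, show 1 - 1 / (2 * ((a + b) / 2) ^ 2) = (a ^ 2 + b ^ 2) / (a + b) ^ 2 by
    field_simp; linear_combination 2 * hab]
  rw [div_le_div_iff₀ (by positivity) (by positivity)]
  calc (a ^ (n + 2) + b ^ (n + 2)) * (a + b) ^ 2
      ≤ ((a ^ 2 + b ^ 2) * (a + b) ^ n) * (a + b) ^ 2 := by gcongr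
    _ = (a ^ 2 + b ^ 2) * (a + b) ^ (n + 2) := by ring

theorem subsolution_nonpos (n : ℕ) (c x : ℝ) : subsolution n c x ≤ 0 := by
  have h1 := exp_two_mul_subsolution_le n c x
  have h2 : 0 ≤ 1 / (2 * Real.cosh (c * x) ^ 2) := by positivity
  have h3 : Real.exp (2 * subsolution n c x) ≤ 1 := by linarith
  rw [Real.exp_le_one_iff] at h3
  linarith

theorem le_subsolution (n : ℕ) {c : ℝ} (x : ℝ) :
    -((n + 2) / 2 * Real.log 2) ≤ subsolution n c x := by
  have h1 := abs_le_logTwoCosh ((n + 2) * c * x)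
  have h2 := logTwoCosh_le (c * x)
  have h3 : |(n + 2) * c * x| = (n + 2) * |c * x| := by
    rw [mul_assoc, abs_mul, abs_of_nonneg (by positivity)]
  have h4 := mul_le_mul_of_nonneg_left h2 (by positivity : (0 : ℝ) ≤ n + 2)
  rw [subsolution]
  linarith

theorem tendsto_subsolution_atTop (n : ℕ) {c : ℝ} (hc : 0 < c) :
    Tendsto (subsolution n c) atTop (𝓝 0) := by
  have h1 := tendsto_logTwoCosh_sub_atTop (c := (n + 2) * c) (by positivity)
  have h2 := (tendsto_logTwoCosh_sub_atTop hc).const_mul ((n : ℝ) + 2)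
  have h3 := (h1.sub h2).const_mul (1 / 2)
  simp only [mul_zero, sub_zero] at h3
  refine h3.congr fun x => ?_
  rw [subsolution]; ring

theorem tendsto_subsolution_atBot (n : ℕ) {c : ℝ} (hc : 0 < c) :
    Tendsto (subsolution n c) atBot (𝓝 0) := by
  refine ((tendsto_subsolution_atTop n hc).comp tendsto_neg_atBot_atTop).congr fun x => ?_
  simp only [Function.comp, subsolution, mul_neg, logTwoCosh_neg]

/-! ### Existence of the profile -/

/-- The remainder of `exp (2 s) - 1` after its linear part is antitone on `s ≤ 0`, with Lipschitz
constant `2 (1 - exp (-2 M))` on `[-M, 0]`. -/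
theorem exp_remainder_bounds {M s t : ℝ} (hs : -M ≤ s) (hst : s ≤ t) (ht : t ≤ 0) :
    0 ≤ (Real.exp (2 * s) - 1 - 2 * s) - (Real.exp (2 * t) - 1 - 2 * t) ∧
    (Real.exp (2 * s) - 1 - 2 * s) - (Real.exp (2 * t) - 1 - 2 * t) ≤
      2 * (1 - Real.exp (-(2 * M))) * (t - s) := by
  have h1 : Real.exp (2 * t) = Real.exp (2 * s) * Real.exp (2 * (t - s)) := by
    rw [← Real.exp_add]; ring_nf
  have h2 : Real.exp (2 * s) = Real.exp (2 * t) * Real.exp (-(2 * (t - s))) := by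
    rw [← Real.exp_add]; ring_nf
  have h3 := Real.add_one_le_exp (2 * (t - s))
  have h4 := Real.add_one_le_exp (-(2 * (t - s)))
  have h5 : Real.exp (2 * t) ≤ 1 := Real.exp_le_one_iff.2 (by linarith)
  have h6 : Real.exp (-(2 * M)) ≤ Real.exp (2 * s) := Real.exp_le_exp.2 (by linarith)
  have h7 := mul_le_mul_of_nonneg_left h3 (Real.exp_pos (2 * s)).le
  have h8 := mul_le_mul_of_nonneg_left h4 (Real.exp_pos (2 * t)).le
  have h9 := mul_le_mul_of_nonneg_right h6 (by linarith : 0 ≤ 2 * (t - s))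
  have h10 := mul_le_mul_of_nonneg_right h5 (by linarith : 0 ≤ 2 * (t - s))
  rw [← h1] at h7
  rw [← h2] at h8
  constructor
  · linarith
  · linarith

/-- `v`, with derivative `v'`, is a nonpositive solution of
`v'' = β (exp (2 v) - 1) + m² / (2 cosh² (m x))` that vanishes at `±∞`. For a wall,
`exp (2 v) = f² + g²`. -/
structure IsProfile (β m : ℝ) (v v' : ℝ → ℝ) : Prop where
  hasDerivAt : ∀ x, HasDerivAt v (v' x) x
  hasDerivAt_deriv : ∀ x, HasDerivAt v' (β * (Real.exp (2 * v x) - 1) +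
    m ^ 2 / (2 * Real.cosh (m * x) ^ 2)) x
  nonpos : ∀ x, v x ≤ 0
  tendsto_atBot : Tendsto v atBot (𝓝 0)
  tendsto_atTop : Tendsto v atTop (𝓝 0)

open BoundedContinuousFunction in
/-- The inverse of `w ↦ w'' - 2 β w` turns the equation into a fixed point problem. Between the
subsolution and `0` the fixed point map is a contraction for the supremum norm. -/
theorem exists_profile {β m : ℝ} (hβ : 0 < β) (hm : 0 < m) :
    ∃ v v' : ℝ → ℝ, IsProfile β m v v' := by
  obtain ⟨n, hn⟩ := exists_nat_ge (m ^ 2 / β)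
  have hn' : m ^ 2 / (n + 2) ≤ β := by
    rw [div_le_iff₀ hβ] at hn
    rw [div_le_iff₀ (by positivity)]
    linarith
  set c : ℝ := m / (n + 2) with hc
  have hc0 : 0 < c := by positivity
  have hcm : (n + 2) * c = m := by rw [hc]; field_simp
  set M : ℝ := (n + 2) / 2 * Real.log 2 with hM
  have hM0 : 0 ≤ M := mul_nonneg (by positivity) (Real.log_nonneg one_le_two)
  set k : ℝ := √(2 * β) with hk
  have hk0 : 0 < k := Real.sqrt_pos.2 (by positivity)
  have hk2 : k ^ 2 = 2 * β := Real.sq_sqrt (by positivity)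
  set q : ℝ → ℝ := fun x => m ^ 2 / (2 * Real.cosh (m * x) ^ 2) with hq
  have hq0 : ∀ x, 0 ≤ q x := fun x => by simp only [hq]; positivity
  have hqm : ∀ x, q x ≤ m ^ 2 := fun x => by
    simp only [hq]
    refine div_le_self (sq_nonneg m) ?_
    nlinarith [Real.one_le_cosh (m * x)]
  have hqc : Continuous q := by
    refine Continuous.div (by fun_prop) (by fun_prop) fun x => ?_
    have := Real.cosh_pos (m * x)
    positivity
  set ψ : ℝ → ℝ := fun s => Real.exp (2 * s) - 1 - 2 * s with hψ
  have hψ0 : ∀ s, 0 ≤ ψ s := fun s => by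
    simp only [hψ]
    linarith [Real.add_one_le_exp (2 * s)]
  have hψc : Continuous ψ := by fun_prop
  have hT : ∀ v : ℝ →ᵇ ℝ, ∃ (w : ℝ →ᵇ ℝ) (w' : ℝ → ℝ), (∀ x, HasDerivAt w (w' x) x) ∧
      ∀ x, HasDerivAt w' (k ^ 2 * w x + (q x + β * ψ (v x))) x := by
    intro v
    have hv : ∀ x, |v x| ≤ ‖v‖ := fun x => v.norm_coe_le_norm x
    obtain ⟨w, w', hw, hw', D, hD⟩ := exists_bounded_solution_second_order hk0
      (φ := fun x => q x + β * ψ (v x))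
      (B := m ^ 2 + β * (Real.exp (2 * ‖v‖) + 2 * ‖v‖)) (by fun_prop) (fun x => by
        have hvx := abs_le.1 (hv x)
        have h1 : ψ (v x) ≤ Real.exp (2 * ‖v‖) + 2 * ‖v‖ := by
          have := Real.exp_le_exp.2 (by linarith : 2 * v x ≤ 2 * ‖v‖)
          simp only [hψ]
          linarith
        rw [abs_of_nonneg (add_nonneg (hq0 x) (mul_nonneg hβ.le (hψ0 _)))]
        exact add_le_add (hqm x) (mul_le_mul_of_nonneg_left h1 hβ.le))
    have hwc : Continuous w := continuous_iff_continuousAt.2 fun x => (hw x).continuousAt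
    exact ⟨ofNormedAddCommGroup w hwc D hD, w', hw, hw'⟩
  choose T T' hTd hTd' using hT
  have hbdd : ∀ (w : ℝ →ᵇ ℝ) x, |w x| ≤ ‖w‖ := fun w x => w.norm_coe_le_norm x
  set S : Set (ℝ →ᵇ ℝ) := {v | ∀ x, subsolution n c x ≤ v x ∧ v x ≤ 0} with hS
  have hSclosed : IsClosed S := by
    rw [hS, Set.ofPred_forall]
    refine isClosed_iInter fun x => ?_
    have hev : Continuous fun v : ℝ →ᵇ ℝ => v x := by fun_prop
    exact (isClosed_le continuous_const hev).inter (isClosed_le hev continuous_const)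
  have hmaps : Set.MapsTo T S S := by
    intro v hv x
    constructor
    · have h := nonneg_of_second_deriv_le (w := fun x => T v x - subsolution n c x)
        (B := ‖T v‖) hk0 (fun x => (hTd v x).sub (hasDerivAt_subsolution n c x))
        (fun x => (hTd' v x).sub (hasDerivAt_deriv_subsolution n c x)) (fun x => ?_) (fun x => ?_) x
      · linarith
      · linarith [(abs_le.1 (hbdd (T v) x)).1, subsolution_nonpos n c x]
      · have h1 := (exp_remainder_bounds (le_refl (-(-subsolution n c x)))
          (by simpa using (hv x).1) (hv x).2).1
        rw [neg_neg] at h1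
        have h2 := exp_two_mul_subsolution_le n c x
        have h3 := mul_le_mul_of_nonneg_left h1 hβ.le
        have h4 := mul_le_mul_of_nonneg_left h2 hβ.le
        have h5 : 1 / 2 * (((n + 2) * c) ^ 2 / Real.cosh ((n + 2) * c * x) ^ 2 -
            (n + 2) * (c ^ 2 / Real.cosh (c * x) ^ 2)) =
            q x - m ^ 2 / (n + 2) * (1 / (2 * Real.cosh (c * x) ^ 2)) := by
          have := Real.cosh_pos (c * x)
          have := Real.cosh_pos (m * x)
          rw [hcm, hc]
          simp only [hq]
          field_simp
        have h6 := mul_le_mul_of_nonneg_right hn'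
          (by positivity : 0 ≤ 1 / (2 * Real.cosh (c * x) ^ 2))
        rw [h5, hk2]
        simp only [hψ]
        linarith
    · have h := nonneg_of_second_deriv_le (w := fun x => -T v x) (B := ‖T v‖) hk0
        (fun x => (hTd v x).neg) (fun x => (hTd' v x).neg) (fun x => ?_) (fun x => ?_) x
      · linarith
      · linarith [(abs_le.1 (hbdd (T v) x)).2]
      · linarith [hq0 x, mul_nonneg hβ.le (hψ0 (v x))]
  set θ : ℝ := 1 - Real.exp (-(2 * M)) with hθ
  have hθ0 : 0 ≤ θ := sub_nonneg.2 (Real.exp_le_one_iff.2 (by linarith))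
  have hθ1 : θ < 1 := by linarith [Real.exp_pos (-(2 * M))]
  have hψlip : ∀ v ∈ S, ∀ w ∈ S, ∀ x, ψ (v x) - ψ (w x) ≤ 2 * θ * dist v w := by
    intro v hv w hw x
    have hd : |v x - w x| ≤ dist v w := dist_coe_le_dist (f := v) (g := w) x
    have hd0 : 0 ≤ dist v w := dist_nonneg
    rcases le_total (v x) (w x) with h | h
    · have h1 := (exp_remainder_bounds ((le_subsolution n x).trans (hv x).1) h (hw x).2).2
      refine h1.trans (mul_le_mul_of_nonneg_left ?_ (by positivity))
      linarith [neg_abs_le (v x - w x)]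
    · have h1 := (exp_remainder_bounds ((le_subsolution n x).trans (hw x).1) h (hv x).2).1
      have h2 : 0 ≤ 2 * θ * dist v w := by positivity
      simp only [hψ]
      linarith
  have hTlip : ∀ v ∈ S, ∀ w ∈ S, ∀ x, T v x - T w x ≤ θ * dist v w := by
    intro v hv w hw x
    have h := nonneg_of_second_deriv_le (w := fun x => θ * dist v w - (T v x - T w x))
      (B := ‖T v‖ + ‖T w‖) hk0
      (fun x => ((hTd v x).sub (hTd w x)).const_sub _)
      (fun x => ((hTd' v x).sub (hTd' w x)).neg) (fun x => ?_) (fun x => ?_) x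
    · linarith
    · have : 0 ≤ θ * dist v w := mul_nonneg hθ0 dist_nonneg
      linarith [(abs_le.1 (hbdd (T v) x)).2, (abs_le.1 (hbdd (T w) x)).1]
    · have h1 := mul_le_mul_of_nonneg_left (hψlip w hw v hv x) hβ.le
      rw [dist_comm w v] at h1
      rw [hk2]
      linarith
  have hcontr : ContractingWith ⟨θ, hθ0⟩ (hmaps.restrict T S S) := by
    refine ⟨by exact_mod_cast hθ1, LipschitzWith.of_dist_le_mul fun v w => ?_⟩
    refine (dist_le (mul_nonneg hθ0 dist_nonneg)).2 fun x => ?_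
    have h1 := hTlip v v.2 w w.2 x
    have h2 := hTlip w w.2 v v.2 x
    rw [dist_comm (w : ℝ →ᵇ ℝ) v] at h2
    rw [Real.dist_eq, abs_le]
    refine ⟨?_, h1⟩
    change -(θ * dist v.1 w.1) ≤ T v x - T w x
    linarith
  have h0S : (0 : ℝ →ᵇ ℝ) ∈ S := fun x => ⟨subsolution_nonpos n c x, le_rfl⟩
  obtain ⟨v, hvS, hfix, -⟩ := ContractingWith.exists_fixedPoint' hSclosed.isComplete hmaps hcontr
    h0S (edist_ne_top _ _)
  have hfix' : T v = v := hfix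
  refine ⟨v, T' v, fun x => ?_, fun x => ?_, fun x => (hvS x).2, ?_, ?_⟩
  · simpa only [hfix'] using hTd v x
  · refine (hTd' v x).congr_deriv ?_
    rw [hfix', hk2]
    simp only [hψ, hq]
    ring
  · exact tendsto_of_tendsto_of_tendsto_of_le_of_le (tendsto_subsolution_atBot n hc0)
      tendsto_const_nhds (fun x => (hvS x).1) (fun x => (hvS x).2)
  · exact tendsto_of_tendsto_of_tendsto_of_le_of_le (tendsto_subsolution_atTop n hc0)
      tendsto_const_nhds (fun x => (hvS x).1) (fun x => (hvS x).2)

/-! ### Decay of the profile -/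

theorem IsProfile.neg {β m : ℝ} (hm : 0 < m) {v v' : ℝ → ℝ} (hv : IsProfile β m v v') (x : ℝ) :
    v x < 0 := by
  refine lt_of_le_of_ne (hv.nonpos x) fun h0 => ?_
  -- a zero of `v` would be a maximum at which `v'' > 0`
  have hmin : IsLocalMin (fun y => -v y) x :=
    Eventually.of_forall fun y => by simp only [h0]; linarith [hv.nonpos y]
  have h1 := hmin.second_deriv_nonneg (fun y => (hv.hasDerivAt y).neg) (hv.hasDerivAt_deriv x).neg
  have h2 : 0 < m ^ 2 / (2 * Real.cosh (m * x) ^ 2) := by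
    have := Real.cosh_pos (m * x)
    positivity
  rw [h0] at h1
  norm_num at h1
  linarith

theorem hasDerivAt_mul_exp_neg_mul (A s x : ℝ) :
    HasDerivAt (fun x => A * Real.exp (-(s * x))) (-s * A * Real.exp (-(s * x))) x :=
  (((hasDerivAt_id x).const_mul s).neg.exp.const_mul A).congr_deriv (by simp; ring)

theorem tendsto_exp_neg_mul_atTop {s : ℝ} (hs : 0 < s) :
    Tendsto (fun x => Real.exp (-(s * x))) atTop (𝓝 0) :=
  Real.tendsto_exp_atBot.comp (tendsto_neg_atTop_atBot.comp (tendsto_id.const_mul_atTop hs))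

/-- Comparison with the exact solution `A exp (-κ x) + D exp (-ρ x)` of
`y'' = κ² y - C exp (-ρ x)`, which exists since `κ ≠ ρ`. -/
theorem exp_decay_of_second_deriv_ge {y y' y'' : ℝ → ℝ} {κ ρ C : ℝ} (hκ : 0 < κ) (hρ : 0 < ρ)
    (hne : κ ≠ ρ) (hy : ∀ x, HasDerivAt y (y' x) x) (hy' : ∀ x, HasDerivAt y' (y'' x) x)
    (hge : ∀ᶠ x in atTop, κ ^ 2 * y x - C * Real.exp (-(ρ * x)) ≤ y'' x)
    (hlim : Tendsto y atTop (𝓝 0)) :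
    ∃ A, ∀ᶠ x in atTop, y x ≤ A * Real.exp (-(min κ ρ * x)) := by
  obtain ⟨a, ha⟩ := eventually_atTop.1 hge
  set D := C / (κ ^ 2 - ρ ^ 2) with hD
  have hne' : κ ^ 2 - ρ ^ 2 ≠ 0 := by
    rw [sq_sub_sq]
    exact mul_ne_zero (by positivity) (sub_ne_zero.2 hne)
  have hDC : D * (κ ^ 2 - ρ ^ 2) = C := div_mul_cancel₀ _ hne'
  set A := (y a - D * Real.exp (-(ρ * a))) * Real.exp (κ * a) with hA
  have hAa : A * Real.exp (-(κ * a)) = y a - D * Real.exp (-(ρ * a)) := by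
    rw [hA, mul_assoc, ← Real.exp_add]; simp
  refine ⟨|A| + |D|, ?_⟩
  filter_upwards [eventually_ge_atTop a, eventually_ge_atTop 0] with x hx hx0
  have h := nonneg_on_Ici_of_second_deriv_neg
    (w := fun x => A * Real.exp (-(κ * x)) + D * Real.exp (-(ρ * x)) - y x)
    (fun x => ((hasDerivAt_mul_exp_neg_mul A κ x).add (hasDerivAt_mul_exp_neg_mul D ρ x)).sub (hy x))
    (fun x => ((hasDerivAt_mul_exp_neg_mul _ κ x).add
      (hasDerivAt_mul_exp_neg_mul _ ρ x)).sub (hy' x)) (a := a) ?_ ?_ ?_ hx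
  · have h1 : A * Real.exp (-(κ * x)) ≤ |A| * Real.exp (-(min κ ρ * x)) := by
      refine mul_le_mul (le_abs_self A) (Real.exp_le_exp.2 (neg_le_neg ?_)) (Real.exp_pos _).le
        (abs_nonneg A)
      exact mul_le_mul_of_nonneg_right (min_le_left _ _) hx0
    have h2 : D * Real.exp (-(ρ * x)) ≤ |D| * Real.exp (-(min κ ρ * x)) := by
      refine mul_le_mul (le_abs_self D) (Real.exp_le_exp.2 (neg_le_neg ?_)) (Real.exp_pos _).le
        (abs_nonneg D)
      exact mul_le_mul_of_nonneg_right (min_le_right _ _) hx0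
    linarith
  · intro z hz hneg
    have h1 := ha z hz.le
    have h2 := mul_neg_of_pos_of_neg (by positivity : 0 < κ ^ 2) hneg
    have h3 : D * (κ ^ 2 - ρ ^ 2) * Real.exp (-(ρ * z)) = C * Real.exp (-(ρ * z)) := by rw [hDC]
    linarith
  · linarith
  · have h1 := (tendsto_exp_neg_mul_atTop hκ).const_mul A
    have h2 := (tendsto_exp_neg_mul_atTop hρ).const_mul D
    simpa using (h1.add h2).sub hlim

theorem one_sub_exp_neg_ge {y : ℝ} (hy : 0 ≤ y) :
    2 * y - 4 * y ^ 2 ≤ 1 - Real.exp (-(2 * y)) := by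
  have h1 := Real.add_one_le_exp (2 * y)
  have h2 : Real.exp (-(2 * y)) * Real.exp (2 * y) = 1 := by rw [← Real.exp_add]; simp
  have h3 : Real.exp (-(2 * y)) * (1 + 2 * y) ≤ 1 := by
    nlinarith [Real.exp_pos (-(2 * y))]
  have h4 : 1 ≤ (1 - 2 * y + 4 * y ^ 2) * (1 + 2 * y) := by nlinarith [pow_nonneg hy 3]
  have h5 := le_of_mul_le_mul_right (h3.trans h4) (by linarith)
  linarith

theorem sech_sq_le (m x : ℝ) :
    m ^ 2 / (2 * Real.cosh (m * x) ^ 2) ≤ 2 * m ^ 2 * Real.exp (-(2 * m * x)) := by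
  have hpos := Real.cosh_pos (m * x)
  have h1 : Real.exp (m * x) ≤ 2 * Real.cosh (m * x) := by
    rw [two_mul_cosh]; linarith [Real.exp_pos (-(m * x))]
  have h2 : Real.exp (m * x) ^ 2 ≤ (2 * Real.cosh (m * x)) ^ 2 := by gcongr
  have h3 : Real.exp (-(2 * m * x)) * Real.exp (m * x) ^ 2 = 1 := by
    rw [← Real.exp_nat_mul, ← Real.exp_add]; push_cast; ring_nf; exact Real.exp_zero
  rw [div_le_iff₀ (by positivity)]
  have h4 := mul_le_mul_of_nonneg_left h2 (Real.exp_pos (-(2 * m * x))).le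
  rw [h3] at h4
  have h5 := mul_le_mul_of_nonneg_left h4 (sq_nonneg m)
  linarith

section Decay

variable {β m k : ℝ} {v v' : ℝ → ℝ}

theorem IsProfile.second_deriv_neg_ge (hv : IsProfile β m v v') (hβ : 0 < β) (hk2 : k ^ 2 = 2 * β)
    (x : ℝ) : k ^ 2 * (-v x) - 2 * k ^ 2 * (-v x) ^ 2 - 2 * m ^ 2 * Real.exp (-(2 * m * x)) ≤
      -(β * (Real.exp (2 * v x) - 1) + m ^ 2 / (2 * Real.cosh (m * x) ^ 2)) := by
  have h1 := mul_le_mul_of_nonneg_left (one_sub_exp_neg_ge (neg_nonneg.2 (hv.nonpos x))) hβ.le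
  rw [show -(2 * -v x) = 2 * v x by ring] at h1
  rw [hk2]
  linarith [sech_sq_le m x]

theorem IsProfile.decay_of_lt (hv : IsProfile β m v v') (hβ : 0 < β) (hm : 0 < m) (hk : 0 < k)
    (hk2 : k ^ 2 = 2 * β) {κ : ℝ} (hκ : 0 < κ) (hκk : κ < k) (hκm : κ ≠ 2 * m) :
    ∃ A, ∀ᶠ x in atTop, -v x ≤ A * Real.exp (-(min κ (2 * m) * x)) := by
  have hlim : Tendsto (fun x => -v x) atTop (𝓝 0) := by simpa using hv.tendsto_atTop.neg
  have hgap : 0 < k ^ 2 - κ ^ 2 := by nlinarith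
  refine exp_decay_of_second_deriv_ge (C := 2 * m ^ 2) hκ (by positivity) hκm
    (fun x => (hv.hasDerivAt x).neg) (fun x => (hv.hasDerivAt_deriv x).neg) ?_ hlim
  -- once `v` is small, the quadratic correction is absorbed by the gap between `κ` and `k`
  filter_upwards [hlim.eventually (gt_mem_nhds
    (by positivity : 0 < (k ^ 2 - κ ^ 2) / (2 * k ^ 2)))] with x hx
  rw [lt_div_iff₀ (by positivity)] at hx
  have h1 := mul_le_mul_of_nonneg_left hx.le (neg_nonneg.2 (hv.nonpos x))
  linarith [hv.second_deriv_neg_ge hβ hk2 x]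

/-- In the case `σ = k < 2 m`, the decay of `v²` at a rate above `k` makes the quadratic correction
harmless. -/
theorem IsProfile.decay (hv : IsProfile β m v v') (hβ : 0 < β) (hm : 0 < m) (hk : 0 < k)
    (hk2 : k ^ 2 = 2 * β) {σ : ℝ} (hσ : 0 < σ)
    (hrate : σ < min k (2 * m) ∨ (σ = min k (2 * m) ∧ k ≠ 2 * m)) :
    ∃ A, ∀ᶠ x in atTop, -v x ≤ A * Real.exp (-(σ * x)) := by
  rcases hrate with hlt | ⟨rfl, hne⟩
  · have h2 := hlt.trans_le (min_le_right _ _)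
    have := hv.decay_of_lt hβ hm hk hk2 hσ (hlt.trans_le (min_le_left _ _)) h2.ne
    rwa [min_eq_left h2.le] at this
  · rcases lt_or_gt_of_ne hne with hlt | hgt
    · rw [min_eq_left hlt.le]
      obtain ⟨A, hA⟩ := hv.decay_of_lt hβ hm hk hk2 (κ := 3 / 4 * k) (by positivity)
        (by linarith) (by linarith)
      rw [min_eq_left (by linarith)] at hA
      set ρ := min (2 * m) (3 / 2 * k) with hρ
      have hkρ : k < ρ := lt_min hlt (by linarith)
      have := exp_decay_of_second_deriv_ge (y := fun x => -v x)
        (C := 2 * k ^ 2 * A ^ 2 + 2 * m ^ 2) hk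
        (hk.trans hkρ) hkρ.ne (fun x => (hv.hasDerivAt x).neg)
        (fun x => (hv.hasDerivAt_deriv x).neg) ?_ (by simpa using hv.tendsto_atTop.neg)
      · rwa [min_eq_left hkρ.le] at this
      filter_upwards [hA, eventually_ge_atTop 0] with x hx hx0
      have h1 : (-v x) ^ 2 ≤ (A * Real.exp (-(3 / 4 * k * x))) ^ 2 :=
        pow_le_pow_left₀ (neg_nonneg.2 (hv.nonpos x)) hx 2
      have h2 : (A * Real.exp (-(3 / 4 * k * x))) ^ 2 = A ^ 2 * Real.exp (-(3 / 2 * k * x)) := by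
        rw [mul_pow, ← Real.exp_nat_mul]; push_cast; ring_nf
      have h3 : Real.exp (-(3 / 2 * k * x)) ≤ Real.exp (-(ρ * x)) :=
        Real.exp_le_exp.2 (neg_le_neg (mul_le_mul_of_nonneg_right (min_le_right _ _) hx0))
      have h4 : Real.exp (-(2 * m * x)) ≤ Real.exp (-(ρ * x)) :=
        Real.exp_le_exp.2 (neg_le_neg (mul_le_mul_of_nonneg_right (min_le_left _ _) hx0))
      have h5 := mul_le_mul_of_nonneg_left h4 (by positivity : 0 ≤ 2 * m ^ 2)
      have h6 := mul_le_mul_of_nonneg_left (h1.trans (h2.le.trans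
        (mul_le_mul_of_nonneg_left h3 (sq_nonneg A)))) (by positivity : 0 ≤ 2 * k ^ 2)
      linarith [hv.second_deriv_neg_ge hβ hk2 x]
    · rw [min_eq_right hgt.le]
      have := hv.decay_of_lt hβ hm hk hk2 (κ := (2 * m + k) / 2) (by positivity)
        (by linarith) (by linarith)
      rwa [min_eq_right (by linarith)] at this

end Decay

theorem exp_decay_of_deriv_le {F F' : ℝ → ℝ} {C σ L : ℝ} (hσ : 0 < σ)
    (hF : ∀ x, HasDerivAt F (F' x) x) (hle : ∀ᶠ x in atTop, F' x ≤ C * Real.exp (-(σ * x)))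
    (hlim : Tendsto F atTop (𝓝 L)) :
    ∀ᶠ x in atTop, L - C / σ * Real.exp (-(σ * x)) ≤ F x := by
  obtain ⟨a, ha⟩ := eventually_atTop.1 hle
  have hG : ∀ x, HasDerivAt (fun x => F x + C / σ * Real.exp (-(σ * x)))
      (F' x + -σ * (C / σ) * Real.exp (-(σ * x))) x := fun x =>
    (hF x).add (hasDerivAt_mul_exp_neg_mul _ σ x)
  have hanti : AntitoneOn (fun x => F x + C / σ * Real.exp (-(σ * x))) (Set.Ici a) := by
    refine antitoneOn_of_hasDerivWithinAt_nonpos (convex_Ici a)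
      (fun x _ => (hG x).continuousAt.continuousWithinAt)
      (fun x _ => (hG x).hasDerivWithinAt) fun x hx => ?_
    have h1 : σ * (C / σ) = C := by field_simp
    have h2 := ha x (interior_subset hx)
    rw [neg_mul, h1]
    linarith
  have hGlim : Tendsto (fun x => F x + C / σ * Real.exp (-(σ * x))) atTop (𝓝 L) := by
    simpa using hlim.add ((tendsto_exp_neg_mul_atTop hσ).const_mul (C / σ))
  filter_upwards [eventually_ge_atTop a] with x hx
  have := le_of_tendsto hGlim (by
    filter_upwards [eventually_ge_atTop x] with y hy
    exact hanti hx (hx.trans hy) hy)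
  linarith

/-! ### Walls: positivity, uniqueness and symmetry -/

namespace IsRescaledWall

variable {β m : ℝ} {h f g : ℝ → ℝ}

theorem hasDerivAt_f (W : IsRescaledWall β m h f g) (x : ℝ) :
    HasDerivAt f (-(m * f x * h x)) x := W.eq_f x ▸ (W.differentiable_f x).hasDerivAt

theorem hasDerivAt_g (W : IsRescaledWall β m h f g) (x : ℝ) :
    HasDerivAt g (-(m * (h x + 1) * g x)) x := W.eq_g x ▸ (W.differentiable_g x).hasDerivAt

theorem hasDerivAt_h (W : IsRescaledWall β m h f g) (hm : 0 < m) (x : ℝ) :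
    HasDerivAt h (β * (1 - (f x ^ 2 + g x ^ 2)) / m) x := by
  refine (W.differentiable_h x).hasDerivAt.congr_deriv ?_
  rw [eq_div_iff hm.ne']
  linarith [W.eq_h x]

/-- The equations for `f` and `g` are linear, so `f` and `g exp (m x)` are multiples of
`exp (-m ∫ h)`. -/
theorem pos_and_exists_ratio (W : IsRescaledWall β m h f g) :
    (∀ x, 0 < f x) ∧ ∃ c > 0, ∀ x, g x = c * f x * Real.exp (-(m * x)) := by
  set H : ℝ → ℝ := fun x => m * ∫ y in (0 : ℝ)..x, h y with hH
  have hHd : ∀ x, HasDerivAt H (m * h x) x := fun x =>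
    (W.differentiable_h.continuous.integral_hasStrictDerivAt 0 x).hasDerivAt.const_mul m
  have hF : ∀ x y, f x * Real.exp (H x) = f y * Real.exp (H y) := by
    have hd : ∀ x, HasDerivAt (fun x => f x * Real.exp (H x)) 0 x := fun x =>
      ((W.hasDerivAt_f x).mul (hHd x).exp).congr_deriv (by ring)
    exact is_const_of_deriv_eq_zero (fun x => (hd x).differentiableAt) fun x => (hd x).deriv
  have hG : ∀ x y, g x * Real.exp (H x + m * x) = g y * Real.exp (H y + m * y) := by
    have hd : ∀ x, HasDerivAt (fun x => g x * Real.exp (H x + m * x)) 0 x := fun x =>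
      ((W.hasDerivAt_g x).mul ((hHd x).add ((hasDerivAt_id x).const_mul m)).exp).congr_deriv
        (by simp only [Pi.add_apply, id]; ring)
    exact is_const_of_deriv_eq_zero (fun x => (hd x).differentiableAt) fun x => (hd x).deriv
  obtain ⟨a, ha⟩ := (W.f_atTop.eventually (lt_mem_nhds one_pos)).exists
  obtain ⟨b, hb⟩ := (W.g_atBot.eventually (lt_mem_nhds one_pos)).exists
  have hf0 : ∀ x, 0 < f x := fun x => by
    have h1 : 0 < f x * Real.exp (H x) := by rw [hF x a]; exact mul_pos ha (Real.exp_pos _)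
    exact pos_of_mul_pos_left h1 (Real.exp_pos _).le
  have hg0 : 0 < g 0 := by
    have h1 : 0 < g 0 * Real.exp (H 0 + m * 0) := by
      rw [hG 0 b]; exact mul_pos hb (Real.exp_pos _)
    exact pos_of_mul_pos_left h1 (Real.exp_pos _).le
  refine ⟨hf0, g 0 / f 0, div_pos hg0 (hf0 0), fun x => ?_⟩
  have h1 := hF x 0
  have h2 := hG x 0
  have h3 : H 0 = 0 := by simp [hH]
  have h4 : Real.exp (m * x) * Real.exp (-(m * x)) = 1 := by rw [← Real.exp_add]; simp
  simp only [h3, Real.exp_add, mul_zero, Real.exp_zero, mul_one] at h1 h2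
  have h5 : g x * Real.exp (m * x) * Real.exp (H x) * f 0
      = g 0 * f x * Real.exp (H x) := by linear_combination f 0 * h2 - g 0 * h1
  have h6 : g x * Real.exp (m * x) * f 0 = g 0 * f x :=
    mul_right_cancel₀ (Real.exp_pos (H x)).ne' (by linarith)
  have hne := (hf0 0).ne'
  field_simp
  linear_combination Real.exp (-(m * x)) * h6 - g x * f 0 * h4

theorem translate (W : IsRescaledWall β m h f g) (a : ℝ) :
    IsRescaledWall β m (fun x => h (x + a)) (fun x => f (x + a)) (fun x => g (x + a)) where
  differentiable_h := W.differentiable_h.comp (differentiable_id.add_const a)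
  differentiable_f := W.differentiable_f.comp (differentiable_id.add_const a)
  differentiable_g := W.differentiable_g.comp (differentiable_id.add_const a)
  eq_h x := by rw [deriv_comp_add_const]; exact W.eq_h (x + a)
  eq_f x := by rw [deriv_comp_add_const]; exact W.eq_f (x + a)
  eq_g x := by rw [deriv_comp_add_const]; exact W.eq_g (x + a)
  h_atBot := W.h_atBot.comp (tendsto_atBot_add_const_right _ a tendsto_id)
  f_atBot := W.f_atBot.comp (tendsto_atBot_add_const_right _ a tendsto_id)
  g_atBot := W.g_atBot.comp (tendsto_atBot_add_const_right _ a tendsto_id)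
  h_atTop := W.h_atTop.comp (tendsto_atTop_add_const_right _ a tendsto_id)
  f_atTop := W.f_atTop.comp (tendsto_atTop_add_const_right _ a tendsto_id)
  g_atTop := W.g_atTop.comp (tendsto_atTop_add_const_right _ a tendsto_id)

theorem reflect (W : IsRescaledWall β m h f g) :
    IsRescaledWall β m (fun x => -1 - h (-x)) (fun x => g (-x)) (fun x => f (-x)) where
  differentiable_h := (W.differentiable_h.comp differentiable_neg).const_sub _
  differentiable_f := W.differentiable_g.comp differentiable_neg
  differentiable_g := W.differentiable_f.comp differentiable_neg
  eq_h x := by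
    rw [deriv_const_sub, deriv_comp_neg]
    linarith [W.eq_h (-x)]
  eq_f x := by rw [deriv_comp_neg, W.eq_g]; ring
  eq_g x := by rw [deriv_comp_neg, W.eq_f]; ring
  h_atBot := by simpa using (W.h_atTop.comp tendsto_neg_atBot_atTop).const_sub (-1)
  f_atBot := W.g_atTop.comp tendsto_neg_atBot_atTop
  g_atBot := W.f_atTop.comp tendsto_neg_atBot_atTop
  h_atTop := by simpa using (W.h_atBot.comp tendsto_neg_atTop_atBot).const_sub (-1)
  f_atTop := W.g_atBot.comp tendsto_neg_atTop_atBot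
  g_atTop := W.f_atBot.comp tendsto_neg_atTop_atBot

variable {h₁ f₁ g₁ h₂ f₂ g₂ : ℝ → ℝ}

/-- Maximum principle for `log f₂ - log f₁`, which vanishes at `∞` because `f₁, f₂ → 1`, and at
`-∞` because it equals `log g₂ - log g₁` and `g₁, g₂ → 1`. -/
theorem f_le_f (hβ : 0 < β) (hm : 0 < m) (W₁ : IsRescaledWall β m h₁ f₁ g₁)
    (W₂ : IsRescaledWall β m h₂ f₂ g₂) (N₁ : ∀ x, g₁ x = f₁ x * Real.exp (-(m * x)))
    (N₂ : ∀ x, g₂ x = f₂ x * Real.exp (-(m * x))) (x : ℝ) : f₁ x ≤ f₂ x := by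
  have p₁ := W₁.pos_and_exists_ratio.1
  have p₂ := W₂.pos_and_exists_ratio.1
  have hlog : ∀ {l : Filter ℝ} {F : ℝ → ℝ}, Tendsto F l (𝓝 1) →
      Tendsto (fun x => Real.log (F x)) l (𝓝 0) := fun hF => by
    have := (Real.continuousAt_log one_ne_zero).tendsto.comp hF
    rwa [Real.log_one] at this
  have hlim : ∀ {l : Filter ℝ}, Tendsto (fun x => Real.log (f₂ x) - Real.log (f₁ x)) l (𝓝 0) →
      ∀ ε > 0, ∀ᶠ x in l, -ε ≤ Real.log (f₂ x) - Real.log (f₁ x) := fun hl ε hε =>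
    (hl.eventually (lt_mem_nhds (neg_lt_zero.2 hε))).mono fun _ => le_of_lt
  have key := nonneg_of_second_deriv_neg (w := fun x => Real.log (f₂ x) - Real.log (f₁ x))
    (w' := fun x => m * (h₁ x - h₂ x))
    (fun x => (((W₂.hasDerivAt_f x).log (p₂ x).ne').sub
      ((W₁.hasDerivAt_f x).log (p₁ x).ne')).congr_deriv (by
        have := (p₁ x).ne'
        have := (p₂ x).ne'
        field_simp
        ring))
    (fun x => ((W₁.hasDerivAt_h hm x).sub (W₂.hasDerivAt_h hm x)).const_mul m) ?_
    (hlim ?_) (hlim (by simpa using (hlog W₂.f_atTop).sub (hlog W₁.f_atTop))) x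
  · exact (Real.log_le_log_iff (p₁ x) (p₂ x)).1 (by linarith)
  · intro x hx
    have h1 : f₂ x < f₁ x := (Real.log_lt_log_iff (p₂ x) (p₁ x)).1 (by linarith)
    have h2 : f₂ x ^ 2 < f₁ x ^ 2 := pow_lt_pow_left₀ h1 (p₂ x).le two_ne_zero
    have h3 : g₂ x ^ 2 < g₁ x ^ 2 := by
      rw [N₁, N₂, mul_pow, mul_pow]
      exact mul_lt_mul_of_pos_right h2 (by positivity)
    have h4 : m * (β * (1 - (f₁ x ^ 2 + g₁ x ^ 2)) / m - β * (1 - (f₂ x ^ 2 + g₂ x ^ 2)) / m)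
        = -(β * (f₁ x ^ 2 - f₂ x ^ 2 + (g₁ x ^ 2 - g₂ x ^ 2))) := by
      field_simp
      ring
    rw [h4]
    exact neg_neg_of_pos (mul_pos hβ (by linarith))
  · have h1 : Tendsto (fun x => Real.log (g₂ x) - Real.log (g₁ x)) atBot (𝓝 0) := by
      simpa using (hlog W₂.g_atBot).sub (hlog W₁.g_atBot)
    refine h1.congr fun x => ?_
    rw [N₁, N₂, Real.log_mul (p₁ x).ne' (Real.exp_pos _).ne',
      Real.log_mul (p₂ x).ne' (Real.exp_pos _).ne']
    ring

theorem eq_of_normalized (hβ : 0 < β) (hm : 0 < m) (W₁ : IsRescaledWall β m h₁ f₁ g₁)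
    (W₂ : IsRescaledWall β m h₂ f₂ g₂) (N₁ : ∀ x, g₁ x = f₁ x * Real.exp (-(m * x)))
    (N₂ : ∀ x, g₂ x = f₂ x * Real.exp (-(m * x))) : h₁ = h₂ ∧ f₁ = f₂ ∧ g₁ = g₂ := by
  have hf : f₁ = f₂ := funext fun x =>
    le_antisymm (f_le_f hβ hm W₁ W₂ N₁ N₂ x) (f_le_f hβ hm W₂ W₁ N₂ N₁ x)
  subst hf
  refine ⟨funext fun x => ?_, rfl, funext fun x => by rw [N₁, N₂]⟩
  have h1 := (W₁.eq_f x).symm.trans (W₂.eq_f x)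
  exact mul_left_cancel₀ (mul_pos hm (W₁.pos_and_exists_ratio.1 x)).ne' (neg_injective h1)

theorem exists_translate_eq (hβ : 0 < β) (hm : 0 < m) (W : IsRescaledWall β m h f g)
    (N : ∀ x, g x = f x * Real.exp (-(m * x))) (W₁ : IsRescaledWall β m h₁ f₁ g₁) :
    ∃ a : ℝ, ∀ x, h₁ x = h (x + a) ∧ f₁ x = f (x + a) ∧ g₁ x = g (x + a) := by
  obtain ⟨-, c, hc, hcg⟩ := W₁.pos_and_exists_ratio
  -- translation by `b` multiplies the ratio of `g exp (m x)` and `f` by `exp (-m b) = 1 / c`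
  set b := Real.log c / m with hb
  have N₁ : ∀ x, g₁ (x + b) = f₁ (x + b) * Real.exp (-(m * x)) := fun x => by
    have h1 : m * b = Real.log c := by rw [hb]; field_simp
    have h2 : Real.exp (-(m * (x + b))) = Real.exp (-(m * x)) / c := by
      rw [mul_add, h1, neg_add', Real.exp_sub, Real.exp_log hc]
    rw [hcg, h2]
    field_simp
  obtain ⟨hh, hf, hg⟩ := eq_of_normalized hβ hm (W₁.translate b) W N₁ N
  refine ⟨-b, fun x => ?_⟩
  rw [← hh, ← hf, ← hg]
  simp

theorem reflect_eq (hβ : 0 < β) (hm : 0 < m) (W : IsRescaledWall β m h f g)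
    (N : ∀ x, g x = f x * Real.exp (-(m * x))) (x : ℝ) :
    h (-x) = -1 - h x ∧ f (-x) = g x ∧ g (-x) = f x := by
  have N' : ∀ x, f (-x) = g (-x) * Real.exp (-(m * x)) := fun x => by
    rw [N, mul_assoc, ← Real.exp_add]; simp
  obtain ⟨hh, hf, hg⟩ := eq_of_normalized hβ hm W.reflect W N' N
  have h1 := congrFun hh x
  have h2 := congrFun hf x
  have h3 := congrFun hg x
  exact ⟨by linarith, h3, h2⟩

end IsRescaledWall

/-! ### Existence and decay of the wall -/

/-- The wall is recovered from the profile by `f = exp u`, `h = -u' / m`, where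
`u = v - log (2 cosh (m x)) / 2 + m x / 2`. -/
theorem IsProfile.exists_wall {β m : ℝ} (hβ : 0 < β) (hm : 0 < m) {v v' : ℝ → ℝ}
    (hv : IsProfile β m v v') : ∃ h f g : ℝ → ℝ, IsRescaledWall β m h f g ∧
      (∀ x, g x = f x * Real.exp (-(m * x))) ∧ ∀ x, f x ^ 2 + g x ^ 2 = Real.exp (2 * v x) := by
  set u : ℝ → ℝ := fun x => v x - 1 / 2 * logTwoCosh (m * x) + m / 2 * x with hu
  set h : ℝ → ℝ := fun x => -(v' x - 1 / 2 * (m * Real.tanh (m * x)) + m / 2) / m with hh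
  set f : ℝ → ℝ := fun x => Real.exp (u x) with hf
  set g : ℝ → ℝ := fun x => f x * Real.exp (-(m * x)) with hg
  have hud : ∀ x, HasDerivAt u (-(m * h x)) x := fun x =>
    (((hv.hasDerivAt x).sub ((hasDerivAt_logTwoCosh m x).const_mul (1 / 2))).add
      ((hasDerivAt_id x).const_mul (m / 2))).congr_deriv (by simp only [hh]; field_simp)
  have hhd : ∀ x, HasDerivAt h (β * (1 - Real.exp (2 * v x)) / m) x := fun x =>
    ((((hv.hasDerivAt_deriv x).sub ((hasDerivAt_mul_tanh m x).const_mul (1 / 2))).add_const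
      (m / 2)).neg.div_const m).congr_deriv (by
        have := Real.cosh_pos (m * x)
        field_simp
        ring)
  have hfd : ∀ x, HasDerivAt f (-(m * f x * h x)) x := fun x =>
    (hud x).exp.congr_deriv (by simp only [hf]; ring)
  have hgd : ∀ x, HasDerivAt g (-(m * (h x + 1) * g x)) x := fun x =>
    ((hfd x).mul ((hasDerivAt_id x).const_mul m).neg.exp).congr_deriv (by
      simp only [hg, id, mul_one, Pi.neg_apply]; ring)
  have hfg : ∀ x, f x ^ 2 + g x ^ 2 = Real.exp (2 * v x) := fun x => by
    have h1 : f x ^ 2 * Real.exp (logTwoCosh (m * x)) =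
        Real.exp (2 * v x) * Real.exp (m * x) := by
      simp only [hf, hu]
      rw [← Real.exp_nat_mul, ← Real.exp_add, ← Real.exp_add]
      push_cast; ring_nf
    rw [exp_logTwoCosh] at h1
    have h2 : Real.exp (m * x) * Real.exp (-(m * x)) = 1 := by rw [← Real.exp_add]; simp
    simp only [hg]
    linear_combination Real.exp (-(m * x)) * h1 + (Real.exp (2 * v x) - f x ^ 2) * h2
  have hmono : Monotone h := by
    refine monotone_of_deriv_nonneg (fun x => (hhd x).differentiableAt) fun x => ?_
    rw [(hhd x).deriv]
    have : Real.exp (2 * v x) ≤ 1 := Real.exp_le_one_iff.2 (by linarith [hv.nonpos x])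
    exact div_nonneg (mul_nonneg hβ.le (by linarith)) hm.le
  have huTop : Tendsto u atTop (𝓝 0) := by
    have := hv.tendsto_atTop.sub ((tendsto_logTwoCosh_sub_atTop hm).const_mul (1 / 2))
    simp only [mul_zero, sub_zero] at this
    exact this.congr fun x => by simp only [hu]; ring
  have huBot : Tendsto (fun x => u x - m * x) atBot (𝓝 0) := by
    have := hv.tendsto_atBot.sub ((tendsto_logTwoCosh_add_atBot hm).const_mul (1 / 2))
    simp only [mul_zero, sub_zero] at this
    exact this.congr fun x => by simp only [hu]; ring
  have hfTop : Tendsto f atTop (𝓝 1) := by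
    have := (Real.continuous_exp.tendsto 0).comp huTop
    rwa [Real.exp_zero] at this
  have hgBot : Tendsto g atBot (𝓝 1) := by
    have := (Real.continuous_exp.tendsto 0).comp huBot
    rw [Real.exp_zero] at this
    refine this.congr fun x => ?_
    simp only [hg, hf, Function.comp, ← Real.exp_add, sub_eq_add_neg]
  have hgTop : Tendsto g atTop (𝓝 0) := by
    simpa using hfTop.mul (tendsto_exp_neg_mul_atTop hm)
  have hfBot : Tendsto f atBot (𝓝 0) := by
    have h1 := hgBot.mul ((tendsto_exp_neg_mul_atTop hm).comp tendsto_neg_atBot_atTop)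
    rw [mul_zero] at h1
    refine h1.congr fun x => ?_
    simp only [hg, Function.comp, mul_assoc, ← Real.exp_add]
    simp
  -- `h` is monotone, so it is squeezed between difference quotients of `u`
  have hquot : ∀ x, m * h x ≤ u x - u (x + 1) ∧ u x - u (x + 1) ≤ m * h (x + 1) := fun x => by
    obtain ⟨ξ, hξ, hξ'⟩ := exists_hasDerivAt_eq_slope u (fun x => -(m * h x))
      (lt_add_one x) (fun y _ => (hud y).continuousAt.continuousWithinAt) (fun y _ => hud y)
    rw [add_sub_cancel_left, div_one] at hξ'
    have h1 := mul_le_mul_of_nonneg_left (hmono hξ.1.le) hm.le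
    have h2 := mul_le_mul_of_nonneg_left (hmono hξ.2.le) hm.le
    constructor <;> linarith
  have hle : ∀ x, h x ≤ (u x - u (x + 1)) / m := fun x => by
    rw [le_div_iff₀' hm]; exact (hquot x).1
  have hge : ∀ x, (u (x - 1) - u x) / m ≤ h x := fun x => by
    have := (hquot (x - 1)).2
    rw [sub_add_cancel] at this
    rwa [div_le_iff₀' hm]
  have hhTop : Tendsto h atTop (𝓝 0) := by
    have h1 := huTop.comp (tendsto_atTop_add_const_right _ (-1) tendsto_id)
    have h2 := huTop.comp (tendsto_atTop_add_const_right _ 1 tendsto_id)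
    have h3 := (h1.sub huTop).div_const m
    have h4 := (huTop.sub h2).div_const m
    simp only [sub_zero, zero_div] at h3 h4
    exact tendsto_of_tendsto_of_tendsto_of_le_of_le h3 h4 hge hle
  have hhBot : Tendsto h atBot (𝓝 (-1)) := by
    have h1 := huBot.comp (tendsto_atBot_add_const_right _ (-1) tendsto_id)
    have h2 := huBot.comp (tendsto_atBot_add_const_right _ 1 tendsto_id)
    have h3 := ((h1.sub huBot).div_const m).sub_const 1
    have h4 := ((huBot.sub h2).div_const m).sub_const 1
    simp only [sub_zero, zero_div, zero_sub] at h3 h4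
    refine tendsto_of_tendsto_of_tendsto_of_le_of_le h3 h4 (fun x => ?_) (fun x => ?_)
    · refine le_trans (le_of_eq ?_) (hge x)
      simp only [Function.comp, id, ← sub_eq_add_neg]
      field_simp
      ring
    · refine (hle x).trans (le_of_eq ?_)
      simp only [Function.comp, id]
      field_simp
      ring
  refine ⟨h, f, g, ⟨fun x => (hhd x).differentiableAt, fun x => (hfd x).differentiableAt,
    fun x => (hgd x).differentiableAt, fun x => ?_, fun x => (hfd x).deriv, fun x => (hgd x).deriv,
    hhBot, hfBot, hgBot, hhTop, hfTop, hgTop⟩, fun x => rfl, hfg⟩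
  rw [(hhd x).deriv, ← hfg]
  field_simp
  ring

namespace IsRescaledWall

variable {β m : ℝ} {h f g v v' : ℝ → ℝ}

theorem strictMono_h (W : IsRescaledWall β m h f g) (hβ : 0 < β) (hm : 0 < m)
    (hv : IsProfile β m v v') (hfg : ∀ x, f x ^ 2 + g x ^ 2 = Real.exp (2 * v x)) :
    StrictMono h := by
  refine strictMono_of_deriv_pos fun x => ?_
  rw [(W.hasDerivAt_h hm x).deriv, hfg]
  have : Real.exp (2 * v x) < 1 := Real.exp_lt_one_iff.2 (by linarith [hv.neg hm x])
  exact div_pos (mul_pos hβ (by linarith)) hm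

theorem h_neg (W : IsRescaledWall β m h f g) (hmono : StrictMono h) (x : ℝ) : h x < 0 :=
  (hmono (lt_add_one x)).trans_le (hmono.monotone.ge_of_tendsto W.h_atTop _)

theorem strictMono_f (W : IsRescaledWall β m h f g) (hm : 0 < m) (hmono : StrictMono h) :
    StrictMono f := by
  refine strictMono_of_deriv_pos fun x => ?_
  rw [W.eq_f]
  exact neg_pos.2 (mul_neg_of_pos_of_neg (mul_pos hm (W.pos_and_exists_ratio.1 x))
    (W.h_neg hmono x))

theorem f_lt_one (W : IsRescaledWall β m h f g) (hm : 0 < m) (hmono : StrictMono h) (x : ℝ) :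
    f x < 1 :=
  (W.strictMono_f hm hmono (lt_add_one x)).trans_le
    ((W.strictMono_f hm hmono).monotone.ge_of_tendsto W.f_atTop _)

/-- Two integrations from `∞`: `h' = β (1 - exp (2 v)) / m` is bounded by a multiple of `-v`, and
`f' = -m f h` by a multiple of `-h`. -/
theorem decay_atTop (W : IsRescaledWall β m h f g) (hβ : 0 < β) (hm : 0 < m) {k : ℝ} (hk : 0 < k)
    (hk2 : k ^ 2 = 2 * β)
    (hv : IsProfile β m v v') (hfg : ∀ x, f x ^ 2 + g x ^ 2 = Real.exp (2 * v x)) {r : ℝ}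
    (hr : r < min k (2 * m) ∨ (r = min k (2 * m) ∧ k ≠ 2 * m)) :
    ∃ C > 0, ∀ᶠ x in atTop, -(C * Real.exp (-(r * x))) < h x ∧
      1 - C * Real.exp (-(r * x)) < f x := by
  have hmono := W.strictMono_h hβ hm hv hfg
  have hμ : 0 < min k (2 * m) := lt_min hk (by positivity)
  -- a nonpositive rate follows from any positive one
  obtain ⟨σ, hσ, hrσ, hrate⟩ : ∃ σ, 0 < σ ∧ r ≤ σ ∧
      (σ < min k (2 * m) ∨ (σ = min k (2 * m) ∧ k ≠ 2 * m)) := by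
    rcases le_or_gt r 0 with h0 | h0
    · exact ⟨min k (2 * m) / 2, by positivity, h0.trans (by positivity), Or.inl (by linarith)⟩
    · exact ⟨r, h0, le_rfl, hr⟩
  obtain ⟨A, hA⟩ := hv.decay hβ hm hk hk2 hσ hrate
  have h1 := exp_decay_of_deriv_le (C := 2 * β / m * A) hσ (W.hasDerivAt_h hm) (by
    filter_upwards [hA] with x hx
    rw [hfg]
    have h2 : 1 - Real.exp (2 * v x) ≤ 2 * (A * Real.exp (-(σ * x))) := by
      linarith [Real.add_one_le_exp (2 * v x)]
    calc β * (1 - Real.exp (2 * v x)) / m ≤ β * (2 * (A * Real.exp (-(σ * x)))) / m := by gcongr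
      _ = 2 * β / m * A * Real.exp (-(σ * x)) := by ring) W.h_atTop
  set B := 2 * β / m * A / σ with hB
  have h3 := exp_decay_of_deriv_le (C := m * |B|) hσ W.hasDerivAt_f (by
    filter_upwards [h1] with x hx
    have h4 : -h x ≤ |B| * Real.exp (-(σ * x)) := by
      linarith [mul_le_mul_of_nonneg_right (le_abs_self B) (Real.exp_pos (-(σ * x))).le]
    have h5 := W.pos_and_exists_ratio.1 x
    have h6 := W.f_lt_one hm hmono x
    have h7 := W.h_neg hmono x
    calc -(m * f x * h x) = m * (f x * -h x) := by ring
      _ ≤ m * (1 * (|B| * Real.exp (-(σ * x)))) := by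
        refine mul_le_mul_of_nonneg_left (mul_le_mul h6.le h4 (by linarith) zero_le_one) hm.le
      _ = m * |B| * Real.exp (-(σ * x)) := by ring) W.f_atTop
  set D := m * |B| / σ with hD
  have hD0 : 0 ≤ D := by positivity
  refine ⟨|B| + D + 1, by positivity, ?_⟩
  filter_upwards [h1, h3, eventually_ge_atTop 0] with x hx1 hx3 hx0
  have h8 : Real.exp (-(σ * x)) ≤ Real.exp (-(r * x)) :=
    Real.exp_le_exp.2 (neg_le_neg (mul_le_mul_of_nonneg_right hrσ hx0))
  have h9 := Real.exp_pos (-(r * x))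
  have h10 := mul_le_mul_of_nonneg_right (le_abs_self B) (Real.exp_pos (-(σ * x))).le
  have h11 := mul_le_mul_of_nonneg_left h8 (abs_nonneg B)
  have h12 := mul_le_mul_of_nonneg_left h8 hD0
  have h13 := mul_nonneg (abs_nonneg B) h9.le
  have h14 := mul_nonneg hD0 h9.le
  constructor <;> linarith

end IsRescaledWall

/-! ### Two-sided estimates -/

theorem IsRescaledWall.exists_estimates {β m k : ℝ} {h f g v v' : ℝ → ℝ}
    (W : IsRescaledWall β m h f g) (N : ∀ x, g x = f x * Real.exp (-(m * x))) (hβ : 0 < β)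
    (hm : 0 < m) (hk : 0 < k) (hk2 : k ^ 2 = 2 * β) (hv : IsProfile β m v v')
    (hfg : ∀ x, f x ^ 2 + g x ^ 2 = Real.exp (2 * v x)) {ε : ℝ} (hε : 0 ≤ ε)
    (hne : ε = 0 → k ≠ 2 * m) :
    ∃ C : ℝ, 0 < C ∧ EstimatesAtBot m (min k (2 * m)) ε C h f g ∧
      EstimatesAtTop m (min k (2 * m)) ε C h f g := by
  have hμ : 0 < min k (2 * m) := lt_min hk (by positivity)
  have hmono := W.strictMono_h hβ hm hv hfg
  obtain ⟨C, hC, hdec⟩ := W.decay_atTop hβ hm hk hk2 hv hfg (r := min k (2 * m) * (1 - ε)) (by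
    rcases hε.eq_or_lt with h0 | h0
    · exact Or.inr ⟨by rw [← h0]; ring, hne h0.symm⟩
    · exact Or.inl (by nlinarith))
  refine ⟨C, hC, ?_, ?_⟩
  · filter_upwards [tendsto_neg_atBot_atTop.eventually hdec] with x hx
    obtain ⟨h1, h2, h3⟩ := W.reflect_eq hβ hm N x
    have h4 := W.h_neg hmono (-x)
    have h5 := W.f_lt_one hm hmono (-x)
    have h6 : f x = Real.exp (m * x) * f (-x) := by
      rw [← h3, N (-x), mul_comm]; simp
    rw [mul_neg, neg_neg, h1] at hx
    rw [h1] at h4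
    refine ⟨⟨by linarith, by linarith [hx.1]⟩, ⟨?_, ?_⟩, ?_, ?_⟩
    · rw [h6]; exact mul_lt_of_lt_one_right (Real.exp_pos _) h5
    · rw [h6]; exact mul_lt_mul_of_pos_left hx.2 (Real.exp_pos _)
    · rwa [← h2]
    · rw [← h2]; exact hx.2
  · filter_upwards [hdec] with x hx
    have h5 := W.f_lt_one hm hmono x
    refine ⟨⟨W.h_neg hmono x, hx.1⟩, ⟨h5, hx.2⟩, ?_, ?_⟩
    · rw [N]; exact mul_lt_of_lt_one_left (Real.exp_pos _) h5
    · rw [N, mul_comm (f x)]; exact mul_lt_mul_of_pos_left hx.2 (Real.exp_pos _)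

/-! ### The wall in the original variables -/

theorem IsRescaledWall.isBPSWall {lam η m : ℝ} (hlam : 0 < lam) {h f g : ℝ → ℝ}
    (W : IsRescaledWall (lam ^ 2 * η ^ 2 / 2) m h f g) :
    IsBPSWall lam η m (fun x => m / lam * h x) (fun x => η * f x) (fun x => η * g x) where
  differentiable_Z := W.differentiable_h.const_mul _
  differentiable_S := W.differentiable_f.const_mul _
  differentiable_P := W.differentiable_g.const_mul _
  eq_Z x := by
    rw [deriv_superpotential_fst, deriv_const_mul _ (W.differentiable_h x)]
    have := W.eq_h x
    field_simp
    linear_combination 2 * this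
  eq_S x := by
    rw [deriv_superpotential_snd, deriv_const_mul _ (W.differentiable_f x), W.eq_f]
    field_simp
  eq_P x := by
    rw [deriv_superpotential_trd, deriv_const_mul _ (W.differentiable_g x), W.eq_g]
    field_simp
  Z_atBot := by simpa using W.h_atBot.const_mul (m / lam)
  S_atBot := by simpa using W.f_atBot.const_mul η
  P_atBot := by simpa using W.g_atBot.const_mul η
  Z_atTop := by simpa using W.h_atTop.const_mul (m / lam)
  S_atTop := by simpa using W.f_atTop.const_mul η
  P_atTop := by simpa using W.g_atTop.const_mul η

theorem IsBPSWall.isRescaledWall {lam η m : ℝ} (hlam : 0 < lam) (hη : 0 < η) (hm : 0 < m)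
    {Z S P : ℝ → ℝ} (W : IsBPSWall lam η m Z S P) :
    IsRescaledWall (lam ^ 2 * η ^ 2 / 2) m (fun x => lam / m * Z x) (fun x => η⁻¹ * S x)
      (fun x => η⁻¹ * P x) where
  differentiable_h := W.differentiable_Z.const_mul _
  differentiable_f := W.differentiable_S.const_mul _
  differentiable_g := W.differentiable_P.const_mul _
  eq_h x := by
    rw [deriv_const_mul _ (W.differentiable_Z x), W.eq_Z, deriv_superpotential_fst]
    field_simp
    ring
  eq_f x := by
    rw [deriv_const_mul _ (W.differentiable_S x), W.eq_S, deriv_superpotential_snd]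
    field_simp
  eq_g x := by
    rw [deriv_const_mul _ (W.differentiable_P x), W.eq_P, deriv_superpotential_trd]
    field_simp
  h_atBot := by
    have := W.Z_atBot.const_mul (lam / m)
    rwa [show lam / m * -(m / lam) = -1 by field_simp] at this
  f_atBot := by simpa using W.S_atBot.const_mul η⁻¹
  g_atBot := by simpa [hη.ne'] using W.P_atBot.const_mul η⁻¹
  h_atTop := by simpa using W.Z_atTop.const_mul (lam / m)
  f_atTop := by simpa [hη.ne'] using W.S_atTop.const_mul η⁻¹
  g_atTop := by simpa using W.P_atTop.const_mul η⁻¹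

theorem wallDecay_of_estimates {lam η m r ε C : ℝ} (hlam : 0 < lam) (hη : 0 < η) (hm : 0 < m)
    {h f g : ℝ → ℝ} (hf : ∀ x, 0 < f x) (hg : ∀ x, 0 < g x)
    (hbot : EstimatesAtBot m r ε C h f g) (htop : EstimatesAtTop m r ε C h f g) :
    WallDecay lam η m (r * (1 - ε)) (fun x => m / lam * h x) (fun x => η * f x)
      (fun x => η * g x) := by
  have hml : 0 < m / lam := by positivity
  have key : ∀ {l : Filter ℝ} {F E : ℝ → ℝ} {a c : ℝ}, 0 < a →
      (∀ᶠ x in l, |F x| ≤ c * Real.exp (E x)) →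
      (fun x => a * F x) =O[l] fun x => Real.exp (E x) := fun {l F E a c} _ hF =>
    IsBigO.const_mul_left (IsBigO.of_bound c (hF.mono fun x hx => by
      rwa [Real.norm_eq_abs, Real.norm_eq_abs, Real.abs_exp])) a
  refine ⟨?_, key (c := 1) hη ?_, ?_, key (c := C) hml ?_, ?_, key (c := 1) hη ?_⟩
  · refine (key (F := fun x => h x + 1) (c := C) hml ?_).congr_left fun x => by ring
    filter_upwards [hbot] with x hx
    rw [abs_le]
    constructor <;> linarith [hx.1.1, hx.1.2]
  · filter_upwards [hbot] with x hx
    rw [abs_of_pos (hf x), one_mul]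
    exact hx.2.1.1.le
  · refine (key (F := fun x => g x - 1) (c := C) hη ?_).congr_left fun x => by ring
    filter_upwards [hbot] with x hx
    rw [abs_le]
    constructor <;> linarith [hx.2.2.1, hx.2.2.2]
  · filter_upwards [htop] with x hx
    rw [abs_le]
    constructor <;> linarith [hx.1.1, hx.1.2]
  · refine (key (F := fun x => f x - 1) (c := C) hη ?_).congr_left fun x => by ring
    filter_upwards [htop] with x hx
    rw [abs_le]
    constructor <;> linarith [hx.2.1.1, hx.2.1.2]
  · filter_upwards [htop] with x hx
    rw [abs_of_pos (hg x), one_mul]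
    exact hx.2.2.1.le

theorem mainTheorem3 (lam η m : ℝ) (hlam : 0 < lam) (hη : 0 < η) (hm : 0 < m) :
    ∃ h f g : ℝ → ℝ,
      -- existence, and normalization of the translate
      IsRescaledWall (lam ^ 2 * η ^ 2 / 2) m h f g ∧
      (∀ x, g x = f x * Real.exp (-(m * x))) ∧
      -- uniqueness up to translation
      (∀ h₁ f₁ g₁ : ℝ → ℝ, IsRescaledWall (lam ^ 2 * η ^ 2 / 2) m h₁ f₁ g₁ →
        ∃ x₀ : ℝ, ∀ x, h₁ x = h (x + x₀) ∧ f₁ x = f (x + x₀) ∧ g₁ x = g (x + x₀)) ∧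
      -- exponential estimates
      (∀ ε : ℝ, 0 < ε → ∃ C : ℝ, 0 < C ∧
        EstimatesAtBot m (min (lam * η) (2 * m)) ε C h f g ∧
        EstimatesAtTop m (min (lam * η) (2 * m)) ε C h f g) ∧
      -- the domain wall in the original variables, and its uniqueness up to translation
      IsBPSWall lam η m (fun x => m / lam * h x) (fun x => η * f x) (fun x => η * g x) ∧
      (∀ Z S P : ℝ → ℝ, IsBPSWall lam η m Z S P →
        ∃ x₀ : ℝ, ∀ x, Z x = m / lam * h (x + x₀) ∧ S x = η * f (x + x₀) ∧
          P x = η * g (x + x₀)) ∧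
      -- decay to the ground states; the loss `ε = 0` is allowed off resonance
      (∀ ε : ℝ, 0 ≤ ε → (ε = 0 → lam * η ≠ 2 * m) →
        WallDecay lam η m (min (lam * η) (2 * m) * (1 - ε))
          (fun x => m / lam * h x) (fun x => η * f x) (fun x => η * g x)) := by
  have hβ : 0 < lam ^ 2 * η ^ 2 / 2 := by positivity
  have hk : 0 < lam * η := by positivity
  have hk2 : (lam * η) ^ 2 = 2 * (lam ^ 2 * η ^ 2 / 2) := by ring
  obtain ⟨v, v', hv⟩ := exists_profile hβ hm
  obtain ⟨h, f, g, W, N, hfg⟩ := hv.exists_wall hβ hm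
  have hf := W.pos_and_exists_ratio.1
  have hg : ∀ x, 0 < g x := fun x => by rw [N]; exact mul_pos (hf x) (Real.exp_pos _)
  refine ⟨h, f, g, W, N, fun h₁ f₁ g₁ W₁ => W.exists_translate_eq hβ hm N W₁,
    fun ε hε => W.exists_estimates N hβ hm hk hk2 hv hfg hε.le fun h0 => absurd h0 hε.ne',
    W.isBPSWall hlam, fun Z S P W₁ => ?_, fun ε hε hne => ?_⟩
  · obtain ⟨a, ha⟩ := W.exists_translate_eq hβ hm N (W₁.isRescaledWall hlam hη hm)
    refine ⟨a, fun x => ?_⟩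
    obtain ⟨h1, h2, h3⟩ := ha x
    rw [← h1, ← h2, ← h3]
    refine ⟨?_, ?_, ?_⟩ <;> field_simp
  · obtain ⟨C, -, hbot, htop⟩ := W.exists_estimates N hβ hm hk hk2 hv hfg hε hne
    exact wallDecay_of_estimates hlam hη hm hf hg hbot htop
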